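/- **Plant.** Vehicles $1,\dots,n$ drive on roads towards an intersection; state $x\in X=\mathbb R^n$ (max norm), $\dot x=v+d$, $v=(v_c,v_{uc})\in V_c\times V_{uc}$ constant on each $[k\tau,(k+1)\tau]$, $V_c,V_{uc}$ nonempty with entries in $\{\mu a,\dots,\mu b\}$ ($\mu,\tau>0$; $a,b\in\mathbb N$), $d(t)\in[d_{\min},d_{\max}]^n$ measurable, $\mu a+d_{\min}\ge\mu$. Put $U_c=\tau V_c$, $U_{uc}=\tau V_{uc}$, $\Delta=[\tau d_{\min},\tau d_{\max}]^n$, and assume that $\tau d_{\min},\tau d_{\max}$ are integer multiples of $\tau\mu$. For vehicle $i$ on road $l$ let $[\alpha_l,\beta_l]$ be the part of the road in the intersection, where $\beta_l\in\tau\mu(\mathbb Z+\frac12)$; the vehicle *has passed* if $x_i>\beta_l$. The bad set $B$ consists of the states in which two vehicles on different roads $l\ne l'$ lie in $[\alpha_l,\beta_l]$ and $[\alpha_{l'},\beta_{l'}]$ respectively, or two vehicles on one road $l$ satisfy $|x_i-x_j|<\gamma$, $x_i,x_j\le\beta_l$. A trajectory is safe on an interval if its distance to $B$ there is bounded below by a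 positive constant. **Detector and estimator.** Let $T=T_{\max}\ge1$ be an integer, $\mathrm{Post}_{u_c}(x)=\{x+(u_c,u_{uc})+\delta: u_{uc}\in U_{uc},\ \delta\in\Delta\}$, and let $\mathrm{Post}_{u_1\dots u_m}$ be its $m$-step version. With thresholds $\eta$ and drifts $b$ (vectors), the CUSUM statistic is $C_i(0)=0$, $C_i(k)=\big(C_i(k-1)+\inf_{\hat x\in \mathrm{Post}_{u_{k-1}}(\tilde x_{k-1})}|\tilde x_i(k)-\hat x_i|-b_i\big)^+$, and $I^s(\tilde x,u,C)=[\hat x_{\min}-\eta-b+C,\ \hat x_{\max}+\eta+b-C]$, where $\hat x_{\min},\hat x_{\max}$ are the coordinatewise extrema of $\mathrm{Post}_u(\tilde x)$. For $\phi=(\tilde x',u_1,\dots,u_T,\tilde x)\in\Phi=X\times U_c^T\times X$ let $\hat I(\phi)$ be the set of states that agree with some element of $\mathrm{Post}_{u_1\dots u_T}(\tilde x')\cup\{\tilde x\}$ up to the positions of vehicles that have passed in both states. Let $I^p(I,u)=\bigcup_{x\in I}\mathrm{Post}_u(x)$. The estimator has a transition $(I,u,I')$ iff $\emptyset\neq I'=I^p(I,u)\cap\hat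 I(\phi)$ for some $\phi\in\Phi$ with last input $u$ whose last measurement $\tilde x$ lies in $I^s(\tilde x'',u,C)$ for some $\tilde x''\in X$, $C\in\mathbb R^n$; it is safe if every trajectory of the plant with input $u$ from a point of $I$ to a point of $I'$ in time $\tau$ is safe. **Discretization.** $\ell(x)_i=c\tau\mu$ if $c\in\mathbb Z$, $c\tau\mu-\tau\mu/2<x_i\le c\tau\mu+\tau\mu/2$ and $x_i\le\beta_l$; $\ell(x)_i=q_{i,m}$ if $x_i>\beta_l$. Let $Q=\ell(X)$ and $q_m=(q_{1,m},\dots,q_{n,m})$. The system $\tilde G$ on $Q$ has: correction events $\lambda^c$, the classes of $\phi\in\Phi$ with equal $\ell(\hat I(\phi))$, defined at $q$ (with $q\mapsto q$) iff $q\in\ell(\hat I(\phi))$; detection events $\lambda^d=(\lambda^s,\tilde q)$, with $\lambda^s$ a class of triples $\theta=(x,u,C)$ with equal $\ell(I^s(\theta))$ and $\tilde q\in Q$, defined (with $q\mapsto q$) iff $\tilde q\in\ell(I^s(\theta))$; inputs $u_c,u_{uc}$ and discretized disturbances $w\in\tau\mu\mathbb Z^n\cap\Delta$, acting by $q\mapsto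 q+(u_c,u_{uc})+w$, where coordinates beyond $\beta_l$ become $q_{i,m}$ and $q_{i,m}$ is absorbing. Here $u_{uc},w$ are unobservable and $u_c$ is controllable. The observer $\mathrm{Obs}(\tilde G)$ has nonempty information states $\iota\subseteq Q$ and observable events in cyclic order $u_c,\lambda^d,\lambda^c$; the marked information state is $\{q_m\}$. A full cycle $(\iota,u,\iota')$ is safe if every estimator transition $(I,u,I')$ with $\ell(I)=\iota$, $\ell(I')=\iota'$ is safe. For an information state $\iota$ reached after a correction, let $K_\iota$ be the set of marked strings of $\mathrm{Obs}(\tilde G)$ from $\iota$ all of whose full cycles are safe, and let $S(\iota)$ be the set of $u_c\in U_c$ that are the first event of some string in the supremal controllable sublanguage $K_\iota^{\uparrow C}$ (the BSCP-NB solution). **Theorem.** The resilient supervisor $\sigma(I)=\{u_c/\tau:u_c\in S(\ell(I))\}$, a map $2^X\to2^{V_c}$ that depends only on $\ell(I)$, solves the resilient supervisory control problem: 1. (safe) if $v_c\in\sigma(I)$ and $x\in I$, then for all $v_{uc}\in V_{uc}$ and all disturbances the trajectory from $x$ is safe for time $\tau$; 2. (non-blocking) if $v_c\in\sigma(I)$,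 $(I,\tau v_c,I')$ is an estimator transition and $\ell(I')\ne\{q_m\}$, then $\sigma(I')\neq\emptyset$; 3. (maximally permissive) if $\tilde\sigma:2^X\to2^{V_c}$ depends only on $\ell(I)$ and satisfies 1 and 2, then $\tilde\sigma(I)\subseteq\sigma(I)$ for every nonempty $I\subseteq X$. Moreover $\sigma$ is resilient to sensor attacks of length at most $T_{\max}$. Consider a closed loop with $x_0\in X_0$, measurements $\tilde x_k=x_k$ except for $k$ in one interval $[k_s,k_e)$ with $k_e-k_s\le T_{\max}$, no detection ($\tilde x_{k+1}\in I^s(\tilde x_k,u_k,C_k)$ for all $k$), estimates $I_0=X_0$, $I_{k+1}=I^p(I_k,u_k)$ for $k+1<T_{\max}$ and $I_{k+1}=I^p(I_k,u_k)\cap\hat I(\tilde x_{k+1-T},u_{k+1-T},\dots,u_k,\tilde x_{k+1})$ for $k+1\ge T_{\max}$, and inputs $u_k/\tau\in\sigma(I_k)$. Then $x_k\in I_k$ for all $k$; the trajectory is safe on each sampling interval; and $\sigma(I_{k+1})\ne\emptyset$ whenever $\ell(I_{k+1})\ne\{q_m\}$, provided that $k+1\ge T_{\max}$ or $X_0$ lies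 in a single cell of $\ell$. If $X_0$ lies in a single cell, there is $K$, depending only on the system and $X_0$, with $\ell(I_k)=\{q_m\}$ for all $k\ge K$. -/

import Mathlib

open Set MeasureTheory

noncomputable section

/-! ### Deterministic generators and supervisory control -/

/-- A deterministic generator: a partial transition function and a set of marked states. -/
structure Generator (St Ev : Type) where
  step : St → Ev → Option St
  marked : Set St

namespace Generator

variable {St Ev : Type}

/-- Extension of the transition function to strings. -/
def run (G : Generator St Ev) : St → List Ev → Option St
  | x, [] => some x
  | x, e :: s => (G.step x e).bind (fun y => run G y s)

/-- The language generated from the initial state `x`. -/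
def lang (G : Generator St Ev) (x : St) : Set (List Ev) :=
  {s | ∃ y, G.run x s = some y}

/-- The language marked from the initial state `x`. -/
def markedLang (G : Generator St Ev) (x : St) : Set (List Ev) :=
  {s | ∃ y ∈ G.marked, G.run x s = some y}

end Generator

/-- Prefix closure of a language. -/
def prefixClosure {Ev : Type} (K : Set (List Ev)) : Set (List Ev) :=
  {s | ∃ t, s ++ t ∈ K}

/-- `K` is controllable with respect to the language `L` and the uncontrollable events `Euc`. -/
def IsControllable {Ev : Type} (Euc : Set Ev) (L K : Set (List Ev)) : Prop :=
  ∀ s ∈ prefixClosure K, ∀ e ∈ Euc, s ++ [e] ∈ L → s ++ [e] ∈ prefixClosure K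

/-- The supremal controllable sublanguage of `K`: the union of all controllable sublanguages. -/
def supC {Ev : Type} (Euc : Set Ev) (L K : Set (List Ev)) : Set (List Ev) :=
  ⋃₀ {K' | K' ⊆ K ∧ IsControllable Euc L K'}

/-! ### The plant -/

/-- Vehicles `Fin n` driving on roads `Fin m` through an intersection, together with the
parameters of the time/space discretization, of the attack detector and of the attacks. -/
structure Intersection where
  /-- number of vehicles -/
  n : ℕ
  /-- number of roads -/
  m : ℕ
  /-- the road of each vehicle -/
  road : Fin n → Fin m
  /-- the controlled vehicles -/
  ctrl : Set (Fin n)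
  /-- `[α l, β l]` is the part of road `l` inside the intersection -/
  α : Fin m → ℝ
  β : Fin m → ℝ
  /-- minimum safe distance on one road -/
  γ : ℝ
  /-- time discretization step -/
  τ : ℝ
  τ_pos : 0 < τ
  /-- speed unit -/
  μ : ℝ
  μ_pos : 0 < μ
  /-- all speeds lie in `{μ a, μ (a + 1), ..., μ b}` -/
  a : ℕ
  b : ℕ
  /-- inputs of the controlled vehicles -/
  Vc : Set (ctrl → ℝ)
  Vc_nonempty : Vc.Nonempty
  Vc_grid : ∀ v ∈ Vc, ∀ i, ∃ k : ℕ, a ≤ k ∧ k ≤ b ∧ v i = μ * k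
  /-- inputs of the uncontrolled vehicles -/
  Vuc : Set ((ctrlᶜ : Set (Fin n)) → ℝ)
  Vuc_nonempty : Vuc.Nonempty
  Vuc_grid : ∀ v ∈ Vuc, ∀ i, ∃ k : ℕ, a ≤ k ∧ k ≤ b ∧ v i = μ * k
  /-- bounds of the disturbance -/
  dmin : ℝ
  dmax : ℝ
  dmin_le_dmax : dmin ≤ dmax
  /-- `μ` is a lower bound of all speeds -/
  μ_le : μ ≤ μ * a + dmin
  /-- `τ dmin` and `τ dmax` are multiples of `τ μ` -/
  dmin_grid : ∃ k : ℤ, dmin = k * μ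
  dmax_grid : ∃ k : ℤ, dmax = k * μ
  /-- the end of the intersection is a cell boundary on every road -/
  β_grid : ∀ l, ∃ c : ℤ, β l = c * (τ * μ) + τ * μ / 2
  /-- detector thresholds -/
  η : Fin n → ℝ
  /-- drift constants of the detector -/
  bias : Fin n → ℝ
  /-- maximal length of an attack, in time steps -/
  T : ℕ
  T_pos : 0 < T

namespace Intersection

variable (M : Intersection)

/-- The continuous state space `X = ℝ^n`, with the maximum norm. -/
abbrev State : Type := Fin M.n → ℝ

/-- The exit position of the road of vehicle `i`. -/
def exit (i : Fin M.n) : ℝ := M.β (M.road i)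

open Classical in
/-- The vector `(v_c, v_uc)`. -/
def join (vc : M.ctrl → ℝ) (vuc : (M.ctrlᶜ : Set (Fin M.n)) → ℝ) : M.State :=
  fun i => if h : i ∈ M.ctrl then vc ⟨i, h⟩ else vuc ⟨i, h⟩

/-- The discrete-time inputs `U_c = τ V_c`. -/
def Uc : Set (M.ctrl → ℝ) := {u | ∃ v ∈ M.Vc, u = M.τ • v}

/-- The discrete-time inputs `U_uc = τ V_uc`. -/
def Uuc : Set ((M.ctrlᶜ : Set (Fin M.n)) → ℝ) := {u | ∃ v ∈ M.Vuc, u = M.τ • v}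

/-- The discrete-time disturbances `Δ = τ D`. -/
def Δ : Set M.State := {δ | ∀ i, M.τ * M.dmin ≤ δ i ∧ δ i ≤ M.τ * M.dmax}

/-- Disturbance signals on one sampling interval `[0, τ]`. -/
def IsDisturbance (d : ℝ → M.State) : Prop :=
  Measurable d ∧ ∀ t ∈ Icc 0 M.τ, ∀ i, d t i ∈ Icc M.dmin M.dmax

/-- The trajectory of `x' = v + d` that starts in `x`, for constant `v`. -/
def traj (x v : M.State) (d : ℝ → M.State) (t : ℝ) : M.State :=
  fun i => x i + t * v i + ∫ s in (0 : ℝ)..t, d s i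

/-- The bad set: collisions in the intersection and rear-end collisions. -/
def Bad : Set M.State :=
  {x | ∃ i j,
    (M.road i ≠ M.road j ∧ x i ∈ Icc (M.α (M.road i)) (M.β (M.road i)) ∧
      x j ∈ Icc (M.α (M.road j)) (M.β (M.road j))) ∨
    (i ≠ j ∧ M.road i = M.road j ∧ |x i - x j| < M.γ ∧ x i ≤ M.exit i ∧ x j ≤ M.exit j)}

/-- The trajectory keeps a positive distance from the bad set on `[0, τ]`. -/
def SafeTraj (x v : M.State) (d : ℝ → M.State) : Prop :=
  ∃ ε > 0, ∀ t ∈ Icc 0 M.τ, ∀ y ∈ M.Bad, ε ≤ dist (M.traj x v d t) y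

/-! ### Detector and estimator -/

/-- States reachable from `x` in one step under the controlled input `u`. -/
def post (x : M.State) (u : M.Uc) : Set M.State :=
  {y | ∃ w ∈ M.Uuc, ∃ δ ∈ M.Δ, y = x + M.join u w + δ}

/-- States reachable from `x` in `N` steps under the controlled inputs `us`. -/
def postSeq {N : ℕ} (x : M.State) (us : Fin N → M.Uc) : Set M.State :=
  {y | ∃ w : Fin N → ((M.ctrlᶜ : Set (Fin M.n)) → ℝ), ∃ δ : Fin N → M.State,
    (∀ j, w j ∈ M.Uuc) ∧ (∀ j, δ j ∈ M.Δ) ∧ y = x + ∑ j, (M.join (us j) (w j) + δ j)}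

/-- The CUSUM statistic after a measurement `y`, given the previous measurement `x`, the
input `u` and the previous statistic `C`. -/
def cusum (x : M.State) (u : M.Uc) (C y : M.State) : M.State :=
  fun i => max (C i + (Metric.infDist (y i) ((fun z : M.State => z i) '' M.post x u) - M.bias i)) 0

/-- Arguments `(x̃, u, C)` of the stealthy attack set. -/
abbrev Theta : Type := M.State × M.Uc × M.State

/-- The stealthy attack set `[x̂_min - η - b + C, x̂_max + η + b - C]`. -/
def stealthy (θ : M.Theta) : Set M.State :=
  {y | ∀ i,
    sInf ((fun z : M.State => z i) '' M.post θ.1 θ.2.1) - M.η i - M.bias i + θ.2.2 i ≤ y i ∧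
    y i ≤ sSup ((fun z : M.State => z i) '' M.post θ.1 θ.2.1) + M.η i + M.bias i - θ.2.2 i}

/-- Two states that differ at most in the positions of vehicles which have passed the
intersection in both of them. -/
def SameUpToPassed (x y : M.State) : Prop :=
  ∀ i, x i = y i ∨ (M.exit i < x i ∧ M.exit i < y i)

/-- Arguments `(x̃_{k-T}, u_{k-T}, ..., u_{k-1}, x̃_k)` of the correction set. -/
abbrev Phi : Type := M.State × (Fin M.T → M.Uc) × M.State

/-- The correction set `Post_{u_{k-T} ... u_{k-1}}(x̃_{k-T}) ∪ {x̃_k}`; of a vehicle that has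
passed the intersection only the fact that it has passed is used. -/
def hatI (φ : M.Phi) : Set M.State :=
  {x | ∃ y ∈ M.postSeq φ.1 φ.2.1 ∪ {φ.2.2}, M.SameUpToPassed x y}

/-- The predicted set. -/
def predict (I : Set M.State) (u : M.Uc) : Set M.State := {y | ∃ x ∈ I, y ∈ M.post x u}

/-- The transitions `(I, u, I')` of the estimator: some past data whose most recent input is `u`
and some measurement which is not detected lead from the estimate `I` to the estimate `I'`. -/
def EstTrans (I : Set M.State) (u : M.Uc) (I' : Set M.State) : Prop :=
  I'.Nonempty ∧ ∃ φ : M.Phi, ∃ θ : M.Theta,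
    φ.2.1 ⟨M.T - 1, Nat.sub_lt M.T_pos Nat.one_pos⟩ = u ∧ θ.2.1 = u ∧
    φ.2.2 ∈ M.stealthy θ ∧ I' = M.predict I u ∩ M.hatI φ

/-- The transition `(x, u, x')` of the discrete-time system is safe: every trajectory from `x`
to `x'` is safe. -/
def SafeStep (x : M.State) (u : M.Uc) (x' : M.State) : Prop :=
  ∀ vuc ∈ M.Vuc, ∀ d, M.IsDisturbance d →
    M.traj x (M.join (M.τ⁻¹ • u.1) vuc) d M.τ = x' →
      M.SafeTraj x (M.join (M.τ⁻¹ • u.1) vuc) d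

/-- The transition `(I, u, I')` of the estimator is safe. -/
def SafeEst (I : Set M.State) (u : M.Uc) (I' : Set M.State) : Prop :=
  ∀ x ∈ I, ∀ x' ∈ I', x' ∈ M.post x u → M.SafeStep x u x'

/-! ### Discretization -/

/-- Discrete states: the cell centre of each vehicle, `none` once it has passed. -/
abbrev Cell : Type := Fin M.n → Option ℝ

/-- The discretization map: `x i` lies in the cell `(c τ μ - τ μ / 2, c τ μ + τ μ / 2]`. -/
def ell (x : M.State) : M.Cell :=
  fun i => if x i ≤ M.exit i then some ((⌈x i / (M.τ * M.μ) - 1 / 2⌉ : ℤ) * (M.τ * M.μ)) else none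

/-- The marked discrete state: all vehicles have passed. -/
def qm : M.Cell := fun _ => none

/-! ### The problem -/

/-- Supervisors: maps from sets of states to sets of inputs in `V_c` that depend only on the
discretization of the set. -/
def IsSupervisor (σ : Set M.State → Set (M.ctrl → ℝ)) : Prop :=
  (∀ I, σ I ⊆ M.Vc) ∧ ∀ I J, M.ell '' I = M.ell '' J → σ I = σ J

/-- Enabled inputs are safe until the next sampling instant, for each state in the estimate. -/
def IsSafe (σ : Set M.State → Set (M.ctrl → ℝ)) : Prop :=
  ∀ I, ∀ vc ∈ σ I, ∀ x ∈ I, ∀ vuc ∈ M.Vuc, ∀ d, M.IsDisturbance d →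
    M.SafeTraj x (M.join vc vuc) d

/-- An enabled input never leads to an unmarked estimate at which no input is enabled. -/
def IsNonblocking (σ : Set M.State → Set (M.ctrl → ℝ)) : Prop :=
  ∀ I, ∀ u : M.Uc, M.τ⁻¹ • u.1 ∈ σ I → ∀ I', M.EstTrans I u I' →
    M.ell '' I' ≠ {M.qm} → (σ I').Nonempty

/-- `σ` allows every input allowed by any safe and non-blocking supervisor. -/
def IsMaximallyPermissive (σ : Set M.State → Set (M.ctrl → ℝ)) : Prop :=
  ∀ σ', M.IsSupervisor σ' → M.IsSafe σ' → M.IsNonblocking σ' →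
    ∀ I : Set M.State, I.Nonempty → σ' I ⊆ σ I

/-! ### The discrete event system and its observer -/

/-- The discretized disturbances. -/
def W : Set M.State :=
  {w | ∀ i, ∃ k : ℤ, ⌊M.τ * M.dmin / (M.τ * M.μ)⌋ ≤ k ∧ k ≤ ⌈M.τ * M.dmax / (M.τ * M.μ)⌉ ∧
    w i = k * (M.τ * M.μ)}

/-- Correction events: classes of `φ` with the same discretized correction set. -/
abbrev LambdaC : Type := Quotient (Setoid.ker (fun φ : M.Phi => M.ell '' M.hatI φ))

/-- Classes of `θ` with the same discretized stealthy attack set. -/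
abbrev LambdaS : Type := Quotient (Setoid.ker (fun θ : M.Theta => M.ell '' M.stealthy θ))

/-- Detection events. -/
abbrev LambdaD : Type := M.LambdaS × M.Cell

/-- The discrete states compatible with a correction event. -/
def corrSet (lam : M.LambdaC) : Set M.Cell :=
  {q | ∃ φ : M.Phi, Quotient.mk _ φ = lam ∧ (M.hatI φ ∩ M.ell ⁻¹' {q}).Nonempty}

/-- The detection event raises no alarm. -/
def NoAlarm (lam : M.LambdaD) : Prop :=
  ∃ θ : M.Theta, Quotient.mk _ θ = lam.1 ∧ (M.stealthy θ ∩ M.ell ⁻¹' {lam.2}).Nonempty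

open Classical in
/-- Detection layer of the transition function. -/
def psiD (q : M.Cell) (lam : M.LambdaD) : Option M.Cell := if M.NoAlarm lam then some q else none

open Classical in
/-- Prediction-correction layer of the transition function. -/
def psiC (q : M.Cell) (lam : M.LambdaC) : Option M.Cell := if q ∈ M.corrSet lam then some q else none

/-- Input and disturbance layers of the transition function. -/
def psiP (q : M.Cell) (u : M.Uc) (w : (M.ctrlᶜ : Set (Fin M.n)) → ℝ) (δ : M.State) : M.Cell :=
  fun i => (q i).bind (fun r =>
    if r + M.join u w i + δ i ≤ M.exit i then some (r + M.join u w i + δ i) else none)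

/-- Observer of the detection layer. -/
def obsD (s : Set M.Cell) (lam : M.LambdaD) : Set M.Cell := {q' | ∃ q ∈ s, M.psiD q lam = some q'}

/-- Observer of the correction layer. -/
def obsC (s : Set M.Cell) (lam : M.LambdaC) : Set M.Cell := {q' | ∃ q ∈ s, M.psiC q lam = some q'}

/-- Observer of the input layer; uncontrolled inputs and disturbances are unobservable. -/
def obsP (s : Set M.Cell) (u : M.Uc) : Set M.Cell :=
  {q' | ∃ q ∈ s, ∃ w ∈ M.Uuc, ∃ δ ∈ M.W, q' = M.psiP q u w δ}

/-- States of the observer: information states in `2^Q`, `2^Q'` and `2^Q''`. -/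
inductive ObsState : Type
  | predicted (s : Set M.Cell)
  | checked (s : Set M.Cell)
  | corrected (s : Set M.Cell)

/-- The information carried by an observer state. -/
def ObsState.info {M : Intersection} : M.ObsState → Set M.Cell
  | .predicted s => s
  | .checked s => s
  | .corrected s => s

/-- Events of the observer. -/
inductive ObsEvent : Type
  | det (lam : M.LambdaD)
  | cor (lam : M.LambdaC)
  | inp (u : M.Uc)

open Classical in
/-- The observer. An event is defined if the resulting information state is nonempty. -/
def Obs : Generator M.ObsState M.ObsEvent where
  step x e :=
    match x, e with
    | .predicted s, .det lam =>
        if (M.obsD s lam).Nonempty then some (.checked (M.obsD s lam)) else none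
    | .checked s, .cor lam =>
        if (M.obsC s lam).Nonempty then some (.corrected (M.obsC s lam)) else none
    | .corrected s, .inp u =>
        if (M.obsP s u).Nonempty then some (.predicted (M.obsP s u)) else none
    | _, _ => none
  marked := {x | x.info = {M.qm}}

/-- The uncontrollable events of the observer: detection and correction. -/
def obsUncontrollable : Set M.ObsEvent := {e | ∀ u, e ≠ ObsEvent.inp u}

/-- Safe transitions of the observer. -/
def SafeObs (s : Set M.Cell) (u : M.Uc) (s' : Set M.Cell) : Prop :=
  ∀ I I', M.EstTrans I u I' → M.ell '' I = s → M.ell '' I' = s' → M.SafeEst I u I'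

/-- The specification from the initial information state `s`: marked strings all of whose
transitions are safe. -/
def spec (s : Set M.Cell) : Set (List M.ObsEvent) :=
  {str | str ∈ M.Obs.markedLang (.corrected s) ∧
    ∀ str₁ str₂ u lamd lamc s₁ s₂,
      str = str₁ ++ [ObsEvent.inp u, ObsEvent.det lamd, ObsEvent.cor lamc] ++ str₂ →
      M.Obs.run (.corrected s) str₁ = some (.corrected s₁) →
      M.Obs.run (.corrected s₁) [ObsEvent.inp u, ObsEvent.det lamd, ObsEvent.cor lamc] =
        some (.corrected s₂) →
      M.SafeObs s₁ u s₂}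

/-- The solution of the basic supervisory control problem, non-blocking case, on the observer:
the controllable events that the supremal controllable sublanguage of the specification
enables at the information state `s`. -/
def bscpnb (s : Set M.Cell) : Set M.Uc :=
  {u | [ObsEvent.inp u] ∈ prefixClosure
    (supC M.obsUncontrollable (M.Obs.lang (.corrected s)) (M.spec s))}

/-- The resilient supervisor `σ(I) = {u_c / τ : u_c ∈ S(ℓ(I))}`. -/
def resilientSupervisor (I : Set M.State) : Set (M.ctrl → ℝ) :=
  {v | ∃ u ∈ M.bscpnb (M.ell '' I), v = M.τ⁻¹ • u.1}

/-! ### Closed-loop runs under sensor attacks -/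

/-- Signals of the closed loop. -/
structure Signals where
  /-- states at the sampling instants -/
  x : ℕ → M.State
  /-- received measurements -/
  meas : ℕ → M.State
  /-- inputs of the controlled vehicles, times `τ` -/
  u : ℕ → M.Uc
  /-- inputs of the uncontrolled vehicles -/
  vuc : ℕ → ((M.ctrlᶜ : Set (Fin M.n)) → ℝ)
  /-- disturbance on each sampling interval -/
  d : ℕ → ℝ → M.State

variable {M} in
/-- Full input vector during the `k`-th interval. -/
def Signals.v (r : M.Signals) (k : ℕ) : M.State := M.join (M.τ⁻¹ • (r.u k).1) (r.vuc k)

variable {M} in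
/-- The detector statistic. -/
def Signals.C (r : M.Signals) : ℕ → M.State
  | 0 => 0
  | k + 1 => M.cusum (r.meas k) (r.u k) (Signals.C r k) (r.meas (k + 1))

variable {M} in
/-- The estimates `I_k`; there is no correction before time `T`. -/
def Signals.est (r : M.Signals) (X₀ : Set M.State) : ℕ → Set M.State
  | 0 => X₀
  | k + 1 =>
    {y | y ∈ M.predict (Signals.est r X₀ k) (r.u k) ∧
      (M.T ≤ k + 1 →
        y ∈ M.hatI (r.meas (k + 1 - M.T), (fun j => r.u (k + 1 - M.T + j)), r.meas (k + 1)))}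

/-- `N` steps of the closed loop under the supervisor `σ` and an undetected sensor attack on a
time interval of length at most `T`. -/
def IsRun (σ : Set M.State → Set (M.ctrl → ℝ)) (X₀ : Set M.State) (N : ℕ) (r : M.Signals) : Prop :=
  r.x 0 ∈ X₀ ∧
  (∃ ks ke : ℕ, ke ≤ ks + M.T ∧ ∀ k ≤ N, k ∉ Ico ks ke → r.meas k = r.x k) ∧
  ∀ k < N,
    M.τ⁻¹ • (r.u k).1 ∈ σ (r.est X₀ k) ∧ r.vuc k ∈ M.Vuc ∧ M.IsDisturbance (r.d k) ∧
    r.x (k + 1) = M.traj (r.x k) (r.v k) (r.d k) M.τ ∧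
    r.meas (k + 1) ∈ M.stealthy (r.meas k, r.u k, r.C k)

/-- Resilience of the closed loop: the estimate contains the true state, every interval is safe,
and at each step an input is enabled unless the estimate is marked. The last claim needs, before
time `T`, that the initial set lies in a single cell; then all vehicles also get through after
a bounded time. -/
def IsResilient (σ : Set M.State → Set (M.ctrl → ℝ)) : Prop :=
  ∀ X₀ : Set M.State,
    (∀ N r, M.IsRun σ X₀ N r →
      (∀ k ≤ N, r.x k ∈ r.est X₀ k) ∧
      (∀ k < N, M.SafeTraj (r.x k) (r.v k) (r.d k)) ∧
      (∀ k < N, (M.T ≤ k + 1 ∨ ∃ q, M.ell '' X₀ = {q}) →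
        M.ell '' r.est X₀ (k + 1) ≠ {M.qm} → (σ (r.est X₀ (k + 1))).Nonempty)) ∧
    ((∃ q, M.ell '' X₀ = {q}) →
      ∃ K, ∀ N r, M.IsRun σ X₀ N r → ∀ k ≤ N, K ≤ k → M.ell '' r.est X₀ k = {M.qm})

end Intersection

end

noncomputable section

namespace Intersection

variable (M : Intersection)

/-! The discretization loses nothing. The ends of the intersection are cell boundaries and the
disturbance bounds are multiples of the cell size, so prediction commutes with `ell`
(`ell_image_predict`). Intersecting with a correction set commutes with `ell` on unions of cells
(`ell_image_predict_inter_hatI`). Detection removes no state, and every correction set can be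
realised with any prescribed last input. So a full observer cycle is `next s u φ`, and it is matched
by an estimator transition from `ell ⁻¹' s`.

The solution `bscpnb` is then a greatest fixed point. Its inputs are safe and lead to marked or
unblocked information states (`bscpnb_safeInput`, `bscpnb_next_nonempty`). Conversely, any policy
with these two properties lies below it (`IsWinning.subset_bscpnb`): every vehicle advances by at
least `τ μ` per step and a correction set bounds the unpassed vehicles from below, so following the
policy reaches the marked state, and the marked strings that follow it form a controllable
sublanguage of the specification.

Safe non-blocking supervisors, read on unions of cells, are such policies; this gives maximality.
The image of an arbitrary estimate may be smaller than the observer's information state, so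
non-blocking also needs antitonicity (`bscpnb_anti`). For resilience, the two ends of a window of
`T` steps cannot both be attacked, so the correction set always contains the true state. -/

theorem step_pos : 0 < M.τ * M.μ := mul_pos M.τ_pos M.μ_pos

/-! ### Grid arithmetic -/

theorem join_grid (u : M.Uc) {w : (M.ctrlᶜ : Set (Fin M.n)) → ℝ} (hw : w ∈ M.Uuc) (i : Fin M.n) :
    ∃ k : ℕ, M.a ≤ k ∧ M.join u w i = k * (M.τ * M.μ) := by
  obtain ⟨u, v, hv, rfl⟩ := u
  obtain ⟨w, hw, rfl⟩ := hw
  by_cases h : i ∈ M.ctrl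
  · obtain ⟨k, h1, -, h2⟩ := M.Vc_grid v hv ⟨i, h⟩
    refine ⟨k, h1, ?_⟩
    simp only [join, h, dif_pos, Pi.smul_apply, h2, smul_eq_mul]
    ring
  · obtain ⟨k, h1, -, h2⟩ := M.Vuc_grid w hw ⟨i, h⟩
    refine ⟨k, h1, ?_⟩
    simp only [join, h, dif_neg, not_false_iff, Pi.smul_apply, h2, smul_eq_mul]
    ring

theorem step_le_join_add (u : M.Uc) {w : (M.ctrlᶜ : Set (Fin M.n)) → ℝ} (hw : w ∈ M.Uuc)
    {δ : M.State} (hδ : δ ∈ M.Δ) (i : Fin M.n) : M.τ * M.μ ≤ M.join u w i + δ i := by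
  obtain ⟨k, hk, h⟩ := M.join_grid u hw i
  have h1 := (hδ i).1
  have h2 : (M.a : ℝ) ≤ k := by exact_mod_cast hk
  have h3 := mul_le_mul_of_nonneg_left M.μ_le M.τ_pos.le
  have h4 := mul_le_mul_of_nonneg_right h2 M.step_pos.le
  rw [h]
  linarith

theorem mem_W_iff {k₀ k₁ : ℤ} (h₀ : M.dmin = k₀ * M.μ) (h₁ : M.dmax = k₁ * M.μ) (w : M.State) :
    w ∈ M.W ↔ ∀ i, ∃ k : ℤ, k₀ ≤ k ∧ k ≤ k₁ ∧ w i = k * (M.τ * M.μ) := by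
  have e (k : ℤ) : M.τ * (k * M.μ) / (M.τ * M.μ) = k := by
    have := M.τ_pos.ne'
    have := M.μ_pos.ne'
    field_simp
  simp only [W, h₀, h₁, e, Int.floor_intCast, Int.ceil_intCast, mem_ofPred_eq]

theorem W_subset_Δ : M.W ⊆ M.Δ := by
  obtain ⟨k₀, h₀⟩ := M.dmin_grid
  obtain ⟨k₁, h₁⟩ := M.dmax_grid
  intro w hw i
  obtain ⟨k, hk0, hk1, hk⟩ := (M.mem_W_iff h₀ h₁ w).1 hw i
  have a0 : (k₀ : ℝ) ≤ k := by exact_mod_cast hk0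
  have a1 : (k : ℝ) ≤ k₁ := by exact_mod_cast hk1
  have b0 := mul_le_mul_of_nonneg_right a0 M.step_pos.le
  have b1 := mul_le_mul_of_nonneg_right a1 M.step_pos.le
  rw [hk, h₀, h₁]
  constructor <;> linarith

theorem W_nonempty : M.W.Nonempty := by
  obtain ⟨k₀, h₀⟩ := M.dmin_grid
  obtain ⟨k₁, h₁⟩ := M.dmax_grid
  refine ⟨fun _ => k₀ * (M.τ * M.μ), (M.mem_W_iff h₀ h₁ _).2 fun i => ⟨k₀, le_rfl, ?_, rfl⟩⟩
  have h := M.dmin_le_dmax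
  rw [h₀, h₁] at h
  exact_mod_cast le_of_mul_le_mul_right h M.μ_pos

theorem Uuc_nonempty : M.Uuc.Nonempty := M.Vuc_nonempty.imp' (M.τ • ·) fun v hv => ⟨v, hv, rfl⟩

instance : Nonempty M.Uc := M.Vc_nonempty.elim fun v hv => ⟨M.τ • v, v, hv, rfl⟩

/-- The index of the cell that contains the position `r`. -/
def idx (r : ℝ) : ℤ := ⌈r / (M.τ * M.μ) - 1 / 2⌉

theorem idx_add (r : ℝ) (k : ℤ) : M.idx (r + k * (M.τ * M.μ)) = M.idx r + k := by
  have := M.step_pos.ne'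
  rw [idx, idx, ← Int.ceil_add_intCast, add_div, mul_div_cancel_right₀ _ this]
  congr 1
  ring

theorem idx_mono : Monotone M.idx := fun r t h => by
  have := M.step_pos
  unfold idx
  gcongr

theorem idx_le_iff (r : ℝ) (c : ℤ) :
    M.idx r ≤ c ↔ r ≤ c * (M.τ * M.μ) + M.τ * M.μ / 2 := by
  have := M.step_pos
  rw [idx, Int.ceil_le, sub_le_iff_le_add, div_le_iff₀ this, add_mul]
  constructor <;> intro h <;> linarith

/-- The exit lies half a step above a grid point. With `idx_le_iff`, a position and the centre of
its cell therefore give the same answer to whether the vehicle has passed. -/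
theorem le_exit_iff (i : Fin M.n) {c : ℤ} (hc : M.exit i = c * (M.τ * M.μ) + M.τ * M.μ / 2)
    (k : ℤ) : k * (M.τ * M.μ) ≤ M.exit i ↔ k ≤ c := by
  have := M.step_pos
  rw [hc]
  constructor
  · intro h
    by_contra hlt
    have h1 : ((c + 1 : ℤ) : ℝ) ≤ k := by exact_mod_cast not_le.1 hlt
    have := mul_le_mul_of_nonneg_right h1 this.le
    push_cast at this
    linarith
  · intro h
    have h1 : (k : ℝ) ≤ c := by exact_mod_cast h
    have := mul_le_mul_of_nonneg_right h1 this.le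
    linarith

theorem exists_exit_eq (i : Fin M.n) : ∃ c : ℤ, M.exit i = c * (M.τ * M.μ) + M.τ * M.μ / 2 :=
  M.β_grid _

theorem ell_apply (x : M.State) (i : Fin M.n) :
    M.ell x i = if x i ≤ M.exit i then some (M.idx (x i) * (M.τ * M.μ)) else none := rfl

theorem ell_eq_none (x : M.State) (i : Fin M.n) : M.ell x i = none ↔ M.exit i < x i := by
  rw [ell_apply]
  split_ifs with h
  · simpa using h
  · simpa using h

theorem ell_congr {x y : M.State} {i : Fin M.n} (h : M.idx (x i) = M.idx (y i)) :
    M.ell x i = M.ell y i := by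
  obtain ⟨c, hc⟩ := M.exists_exit_eq i
  simp only [ell_apply, hc, ← idx_le_iff, h]

theorem ell_eq_of_le {x y : M.State} {i : Fin M.n} (h : M.ell x i = M.ell y i)
    (hx : x i ≤ M.exit i) : M.idx (x i) = M.idx (y i) := by
  rw [ell_apply, ell_apply, if_pos hx] at h
  split_ifs at h
  have := mul_right_cancel₀ M.step_pos.ne' (Option.some.inj h)
  exact_mod_cast this

/-- The discretized dynamics is the exact discretization of the dynamics for disturbances on the
grid. -/
theorem ell_add (x : M.State) (u : M.Uc) {w : (M.ctrlᶜ : Set (Fin M.n)) → ℝ} (hw : w ∈ M.Uuc)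
    {δ : M.State} (hδ : δ ∈ M.W) :
    M.ell (x + M.join u w + δ) = M.psiP (M.ell x) u w δ := by
  obtain ⟨k₀, h₀⟩ := M.dmin_grid
  obtain ⟨k₁, h₁⟩ := M.dmax_grid
  funext i
  obtain ⟨c, hc⟩ := M.exists_exit_eq i
  obtain ⟨j, -, hj⟩ := M.join_grid u hw i
  obtain ⟨k, -, -, hk⟩ := (M.mem_W_iff h₀ h₁ δ).1 hδ i
  have hp := M.step_le_join_add u hw (M.W_subset_Δ hδ) i
  have hs := M.step_pos
  have e : M.join u w i + δ i = ((j + k : ℤ) : ℝ) * (M.τ * M.μ) := by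
    rw [hj, hk]; push_cast; ring
  simp only [psiP, ell_apply, Pi.add_apply, add_assoc]
  by_cases hx : x i ≤ M.exit i
  · simp only [if_pos hx, Option.bind_some, e, idx_add]
    have e2 : (M.idx (x i) : ℝ) * (M.τ * M.μ) + ((j + k : ℤ) : ℝ) * (M.τ * M.μ) =
        ((M.idx (x i) + (j + k) : ℤ) : ℝ) * (M.τ * M.μ) := by push_cast; ring
    rw [e2]
    simp only [M.le_exit_iff i hc]
    simp only [hc, ← idx_le_iff, idx_add]
  -- Displacements are positive, so a vehicle that has passed stays passed.
  · rw [if_neg hx, if_neg (by linarith)]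
    rfl

/-- The grid disturbance is the number of cells crossed. As `idx` is monotone and commutes with grid
shifts, the grid bounds on `δ` bound this number too. -/
theorem exists_grid_disturbance (x : M.State) {δ : M.State} (hδ : δ ∈ M.Δ) :
    ∃ δ' ∈ M.W, M.ell (x + δ) = M.ell (x + δ') := by
  obtain ⟨k₀, h₀⟩ := M.dmin_grid
  obtain ⟨k₁, h₁⟩ := M.dmax_grid
  refine ⟨fun i => ((M.idx (x i + δ i) - M.idx (x i) : ℤ) : ℝ) * (M.τ * M.μ),
    (M.mem_W_iff h₀ h₁ _).2 fun i => ⟨_, ?_, ?_, rfl⟩, funext fun i => M.ell_congr ?_⟩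
  · have h : x i + k₀ * (M.τ * M.μ) ≤ x i + δ i := by
      have := (hδ i).1; rw [h₀] at this; linarith
    have := M.idx_mono h
    rw [idx_add] at this
    linarith
  · have h : x i + δ i ≤ x i + k₁ * (M.τ * M.μ) := by
      have := (hδ i).2; rw [h₁] at this; linarith
    have := M.idx_mono h
    rw [idx_add] at this
    linarith
  · simp only [Pi.add_apply, idx_add]
    ring

/-- Prediction commutes with discretization. -/
theorem ell_image_predict (I : Set M.State) (u : M.Uc) :
    M.ell '' M.predict I u = M.obsP (M.ell '' I) u := by
  ext q
  constructor
  · rintro ⟨_, ⟨x, hx, w, hw, δ, hδ, rfl⟩, rfl⟩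
    obtain ⟨δ', hδ', e⟩ := M.exists_grid_disturbance (x + M.join u w) hδ
    exact ⟨_, ⟨x, hx, rfl⟩, w, hw, δ', hδ', by rw [e, M.ell_add x u hw hδ']⟩
  · rintro ⟨_, ⟨x, hx, rfl⟩, w, hw, δ, hδ, rfl⟩
    exact ⟨_, ⟨x, hx, w, hw, δ, M.W_subset_Δ hδ, rfl⟩, M.ell_add x u hw hδ⟩

theorem SameUpToPassed.refl (x : M.State) : M.SameUpToPassed x x := fun _ => .inl rfl

variable {M} in
theorem SameUpToPassed.trans {x y z : M.State} (h : M.SameUpToPassed x y)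
    (h' : M.SameUpToPassed y z) : M.SameUpToPassed x z := by
  intro i
  rcases h i with h | h <;> rcases h' i with h' | h'
  · exact .inl (h.trans h')
  · exact .inr ⟨h ▸ h'.1, h'.2⟩
  · exact .inr ⟨h.1, h' ▸ h.2⟩
  · exact .inr ⟨h.1, h'.2⟩

/-- On unions of cells, correction commutes with discretization. -/
theorem ell_image_predict_inter_hatI {s : Set M.Cell} (hs : s ⊆ range M.ell) (u : M.Uc)
    (φ : M.Phi) : M.ell '' (M.predict (M.ell ⁻¹' s) u ∩ M.hatI φ) =
      M.obsP s u ∩ M.ell '' M.hatI φ := by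
  obtain ⟨k₀, h₀⟩ := M.dmin_grid
  obtain ⟨k₁, h₁⟩ := M.dmax_grid
  have hP := M.ell_image_predict (M.ell ⁻¹' s) u
  rw [image_preimage_eq_of_subset hs] at hP
  refine Subset.antisymm ((image_inter_subset _ _ _).trans (by rw [hP])) ?_
  rintro q ⟨⟨_, hq, w, hw, δ, hδ, rfl⟩, z, hz, hzq⟩
  obtain ⟨x, rfl⟩ := hs hq
  rw [← M.ell_add x u hw hδ] at hzq
  classical
  set y : M.State := x + M.join u w + δ with hy
  -- Unpassed coordinates of `x` are shifted so that the same move ends exactly at `z`. The move is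
  -- a multiple of the cell size, so `x'` stays in the cell of `x`. Passed coordinates need no
  -- adjustment, since `hatI` ignores where a passed vehicle is.
  let x' : M.State := fun i => if z i ≤ M.exit i then x i + (z i - y i) else x i
  have hx' : M.ell x' = M.ell x := by
    funext i
    by_cases h : z i ≤ M.exit i
    · have e := M.ell_eq_of_le (congrFun hzq i) h
      obtain ⟨j, -, hj⟩ := M.join_grid u hw i
      obtain ⟨k, -, -, hk⟩ := (M.mem_W_iff h₀ h₁ δ).1 hδ i
      apply M.ell_congr
      have e1 : y i = x i + ((j + k : ℤ) : ℝ) * (M.τ * M.μ) := by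
        simp only [hy, Pi.add_apply, hj, hk]; push_cast; ring
      have e2 : z i = x' i + ((j + k : ℤ) : ℝ) * (M.τ * M.μ) := by
        simp only [x', if_pos h]; linarith
      rw [e1, e2, idx_add, idx_add] at e
      linarith
    · exact M.ell_congr (by simp only [x', if_neg h])
  refine ⟨x' + M.join u w + δ, ⟨⟨x', ?_, w, hw, δ, M.W_subset_Δ hδ, rfl⟩, ?_⟩, ?_⟩
  · rw [mem_preimage, hx']; exact hq
  · obtain ⟨p, hp, hzp⟩ := hz
    refine ⟨p, hp, SameUpToPassed.trans ?_ hzp⟩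
    intro i
    by_cases h : z i ≤ M.exit i
    · left
      simp only [x', if_pos h, hy, Pi.add_apply]
      ring
    · right
      refine ⟨?_, not_le.1 h⟩
      have : M.ell z i = none := (M.ell_eq_none z i).2 (not_le.1 h)
      rw [hzq, ell_eq_none] at this
      simpa only [x', if_neg h, hy, Pi.add_apply] using this
  · rw [M.ell_add x' u hw hδ, hx']

/-! ### Trajectories -/

theorem traj_mem_post (x : M.State) (u : M.Uc) {v : (M.ctrlᶜ : Set (Fin M.n)) → ℝ}
    (hv : v ∈ M.Vuc) {d : ℝ → M.State} (hd : M.IsDisturbance d) :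
    M.traj x (M.join (M.τ⁻¹ • u.1) v) d M.τ ∈ M.post x u := by
  have hτ := M.τ_pos
  refine ⟨M.τ • v, ⟨v, hv, rfl⟩, fun i => ∫ s in (0 : ℝ)..M.τ, d s i, fun i => ?_, ?_⟩
  · have hi : IntervalIntegrable (fun s => d s i) volume 0 M.τ := by
      rw [intervalIntegrable_iff_integrableOn_Icc_of_le hτ.le]
      refine Measure.integrableOn_of_bounded (M := max |M.dmin| |M.dmax|) (by simp)
        ((measurable_pi_apply i).comp hd.1).aestronglyMeasurable ?_
      filter_upwards [ae_restrict_mem measurableSet_Icc] with s hs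
      exact abs_le_max_abs_abs (hd.2 s hs i).1 (hd.2 s hs i).2
    constructor
    · have := intervalIntegral.integral_mono_on hτ.le
        (intervalIntegrable_const (c := M.dmin)) hi fun s hs => (hd.2 s hs i).1
      simpa using this
    · have := intervalIntegral.integral_mono_on hτ.le hi
        (intervalIntegrable_const (c := M.dmax)) fun s hs => (hd.2 s hs i).2
      simpa using this
  · funext i
    simp only [traj, Pi.add_apply, join, Pi.smul_apply, smul_eq_mul]
    split_ifs <;> field_simp

/-! ### Correction sets and the stealthy attack set -/

theorem mem_hatI_measurement (x' : M.State) (us : Fin M.T → M.Uc) (x : M.State) :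
    x ∈ M.hatI (x', us, x) := ⟨x, .inr rfl, SameUpToPassed.refl M x⟩

/-- The statistic in `Theta` is an arbitrary vector, and making it negative enough widens the
interval to contain any `y`. Thus the detector does not restrict the transitions of the estimator.
-/
theorem exists_mem_stealthy (x : M.State) (u : M.Uc) (y : M.State) :
    ∃ θ : M.Theta, θ.2.1 = u ∧ y ∈ M.stealthy θ := by
  let lo : M.State := fun i => sInf ((fun z : M.State => z i) '' M.post x u) - M.η i - M.bias i
  let hi : M.State := fun i => sSup ((fun z : M.State => z i) '' M.post x u) + M.η i + M.bias i
  refine ⟨(x, u, fun i => min (y i - lo i) (hi i - y i)), rfl, fun i => ⟨?_, ?_⟩⟩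
  · have := min_le_left (y i - lo i) (hi i - y i)
    change lo i + min (y i - lo i) (hi i - y i) ≤ _
    linarith
  · have := min_le_right (y i - lo i) (hi i - y i)
    change _ ≤ hi i - min (y i - lo i) (hi i - y i)
    linarith

theorem join_add (u : M.ctrl → ℝ) (w : (M.ctrlᶜ : Set (Fin M.n)) → ℝ) :
    M.join u w = M.join u 0 + M.join 0 w := by
  funext i
  simp only [join, Pi.add_apply]
  split_ifs <;> simp

/-- The inputs in the arguments of the correction set are immaterial, up to a shift. -/
theorem postSeq_eq_shift {N : ℕ} (x : M.State) (us us' : Fin N → M.Uc) :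
    M.postSeq x us =
      M.postSeq (x + ∑ j, M.join (us j) 0 - ∑ j, M.join (us' j) 0) us' := by
  ext y
  -- Controlled inputs enter additively, independently of the uncontrolled ones, so their sum can be
  -- moved into the base point.
  have e (w : Fin N → ((M.ctrlᶜ : Set (Fin M.n)) → ℝ)) (δ : Fin N → M.State) :
      x + ∑ j, (M.join (us j) (w j) + δ j) =
        x + ∑ j, M.join (us j) 0 - ∑ j, M.join (us' j) 0 +
          ∑ j, (M.join (us' j) (w j) + δ j) := by
    have h (v : Fin N → M.Uc) : ∑ j, (M.join (v j) (w j) + δ j) =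
        ∑ j, M.join (v j) 0 + ∑ j, M.join 0 (w j) + ∑ j, δ j := by
      rw [← Finset.sum_add_distrib, ← Finset.sum_add_distrib]
      exact Finset.sum_congr rfl fun j _ => by rw [M.join_add (v j)]
    rw [h, h]
    abel
  simp only [postSeq, e]

/-- A correction event of the observer carries no input, whereas an estimator transition requires
the last input of `φ` to be `u`. This reconciles the two. -/
theorem exists_hatI_eq_last (φ : M.Phi) (u : M.Uc) :
    ∃ φ' : M.Phi, φ'.2.1 ⟨M.T - 1, Nat.sub_lt M.T_pos Nat.one_pos⟩ = u ∧ φ'.2.2 = φ.2.2 ∧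
      M.hatI φ' = M.hatI φ := by
  refine ⟨(φ.1 + ∑ j, M.join (φ.2.1 j) 0 - ∑ _j : Fin M.T, M.join u 0, fun _ => u, φ.2.2),
    rfl, rfl, ?_⟩
  simp only [hatI]
  rw [M.postSeq_eq_shift φ.1 φ.2.1 fun _ => u]

theorem estTrans_of_hatI {I : Set M.State} {u : M.Uc} (φ : M.Phi)
    (h : (M.predict I u ∩ M.hatI φ).Nonempty) : M.EstTrans I u (M.predict I u ∩ M.hatI φ) := by
  obtain ⟨φ', h1, h2, h3⟩ := M.exists_hatI_eq_last φ u
  obtain ⟨θ, h4, h5⟩ := M.exists_mem_stealthy 0 u φ'.2.2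
  exact ⟨h, φ', θ, h1, h4, h5, by rw [h3]⟩

theorem le_of_mem_postSeq {N : ℕ} {x y : M.State} {us : Fin N → M.Uc} (h : y ∈ M.postSeq x us)
    (i : Fin M.n) : x i ≤ y i := by
  obtain ⟨w, δ, hw, hδ, rfl⟩ := h
  have : 0 ≤ ∑ j, (M.join (us j) (w j) + δ j) i := Finset.sum_nonneg fun j _ =>
    M.step_pos.le.trans (M.step_le_join_add (us j) (hw j) (hδ j) i)
  simp only [Pi.add_apply, Finset.sum_apply] at this ⊢
  linarith

end Intersection

theorem Generator.run_append {St Ev : Type} (G : Generator St Ev) (x : St) (s t : List Ev) :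
    G.run x (s ++ t) = (G.run x s).bind fun y => G.run y t := by
  induction s generalizing x with
  | nil => rfl
  | cons e s ih =>
    simp only [List.cons_append, Generator.run, Option.bind_assoc, ih]

namespace Intersection

variable (M : Intersection)

/-! ### Transitions of the observer -/

theorem corrSet_mk (φ : M.Phi) : M.corrSet (Quotient.mk _ φ) = M.ell '' M.hatI φ := by
  ext q
  constructor
  · rintro ⟨φ', h, x, hx, hq⟩
    have h : M.ell '' M.hatI φ' = M.ell '' M.hatI φ := Quotient.exact h
    rw [← h]
    exact ⟨x, hx, hq⟩
  · rintro ⟨x, hx, hq⟩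
    exact ⟨φ, rfl, x, hx, hq⟩

theorem obsC_mk (s : Set M.Cell) (φ : M.Phi) :
    M.obsC s (Quotient.mk _ φ) = s ∩ M.ell '' M.hatI φ := by
  rw [← corrSet_mk]
  ext q
  constructor
  · rintro ⟨q', h, h'⟩
    rw [psiC] at h'
    split_ifs at h' with h1
    cases h'
    exact ⟨h, h1⟩
  · rintro ⟨h, h'⟩
    exact ⟨q, h, if_pos h'⟩

/-- The alarm test does not look at the state, so a detection event keeps either every discrete
state or none. -/
theorem obsD_eq {lam : M.LambdaD} (h : M.NoAlarm lam) (s : Set M.Cell) : M.obsD s lam = s := by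
  ext q
  simp [obsD, psiD, h]

theorem noAlarm_of_obsD {lam : M.LambdaD} {s : Set M.Cell} (h : (M.obsD s lam).Nonempty) :
    M.NoAlarm lam := by
  obtain ⟨q, q', -, h⟩ := h
  by_contra hn
  simp [psiD, hn] at h

theorem exists_noAlarm : ∃ lam : M.LambdaD, M.NoAlarm lam := by
  obtain ⟨θ, -, h⟩ := M.exists_mem_stealthy 0 (Classical.arbitrary _) 0
  exact ⟨(Quotient.mk _ θ, M.ell 0), θ, rfl, 0, h, rfl⟩

theorem step_inp {s : Set M.Cell} {u : M.Uc} (h : (M.obsP s u).Nonempty) :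
    M.Obs.step (.corrected s) (.inp u) = some (.predicted (M.obsP s u)) := if_pos h

theorem step_det {s : Set M.Cell} {lam : M.LambdaD} (hl : M.NoAlarm lam) (h : s.Nonempty) :
    M.Obs.step (.predicted s) (.det lam) = some (.checked s) := by
  have hs := M.obsD_eq hl s
  exact (if_pos (by rwa [hs])).trans (by rw [hs])

theorem step_cor {s : Set M.Cell} {φ : M.Phi} (h : (s ∩ M.ell '' M.hatI φ).Nonempty) :
    M.Obs.step (.checked s) (.cor (Quotient.mk _ φ)) =
      some (.corrected (s ∩ M.ell '' M.hatI φ)) := by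
  have hs := M.obsC_mk s φ
  exact (if_pos (by rwa [hs])).trans (by rw [hs])

theorem step_eq_some {x y : M.ObsState} {e : M.ObsEvent} (h : M.Obs.step x e = some y) :
    (∃ s u, x = .corrected s ∧ e = .inp u ∧ y = .predicted (M.obsP s u)) ∨
    (∃ s lam, x = .predicted s ∧ e = .det lam ∧ y = .checked s) ∨
    (∃ s φ, x = .checked s ∧ e = .cor (Quotient.mk _ φ) ∧ (s ∩ M.ell '' M.hatI φ).Nonempty ∧
      y = .corrected (s ∩ M.ell '' M.hatI φ)) := by
  rcases x with s | s | s <;> rcases e with lam | lam | u <;> simp only [Obs, reduceCtorEq] at h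
  · split_ifs at h with hn
    cases h
    exact .inr (.inl ⟨s, lam, rfl, rfl, by rw [M.obsD_eq (M.noAlarm_of_obsD hn)]⟩)
  · induction lam using Quotient.inductionOn with
    | h φ =>
      rw [obsC_mk] at h
      split_ifs at h with hn
      cases h
      exact .inr (.inr ⟨s, φ, rfl, rfl, hn, rfl⟩)
  · split_ifs at h
    cases h
    exact .inl ⟨s, u, rfl, rfl, rfl⟩

/-- The corrected information state after the input `u` and the correction event of `φ`. -/
def next (s : Set M.Cell) (u : M.Uc) (φ : M.Phi) : Set M.Cell :=
  M.obsP s u ∩ M.ell '' M.hatI φ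

theorem next_mono {s t : Set M.Cell} (h : s ⊆ t) (u : M.Uc) (φ : M.Phi) :
    M.next s u φ ⊆ M.next t u φ :=
  inter_subset_inter_left _ fun _ ⟨q, hq, hw⟩ => ⟨q, h hq, hw⟩

theorem obsP_nonempty {s : Set M.Cell} (h : s.Nonempty) (u : M.Uc) : (M.obsP s u).Nonempty := by
  obtain ⟨q, hq⟩ := h
  obtain ⟨w, hw⟩ := M.Uuc_nonempty
  obtain ⟨δ, hδ⟩ := M.W_nonempty
  exact ⟨_, q, hq, w, hw, δ, hδ, rfl⟩

theorem obsP_subset_range {s : Set M.Cell} (h : s ⊆ range M.ell) (u : M.Uc) :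
    M.obsP s u ⊆ range M.ell := by
  rw [← image_preimage_eq_of_subset h, ← M.ell_image_predict]
  exact image_subset_range _ _

theorem next_subset_range (s : Set M.Cell) (u : M.Uc) (φ : M.Phi) :
    M.next s u φ ⊆ range M.ell := inter_subset_right.trans (image_subset_range _ _)

/-- A last measurement inside one of the cells is always consistent with the information state. -/
theorem exists_correction {s : Set M.Cell} (h : s.Nonempty) (hs : s ⊆ range M.ell) :
    ∃ φ : M.Phi, (s ∩ M.ell '' M.hatI φ).Nonempty := by
  obtain ⟨q, hq⟩ := h
  obtain ⟨x, rfl⟩ := hs hq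
  exact ⟨(x, fun _ => Classical.arbitrary _, x), _, hq, x, M.mem_hatI_measurement _ _ _, rfl⟩

theorem run_cycle {s : Set M.Cell} {u : M.Uc} {lam : M.LambdaD} {φ : M.Phi}
    (hl : M.NoAlarm lam) (h : (M.next s u φ).Nonempty) :
    M.Obs.run (.corrected s) [.inp u, .det lam, .cor (Quotient.mk _ φ)] =
      some (.corrected (M.next s u φ)) := by
  have hP := h.mono inter_subset_left
  simp only [Generator.run, M.step_inp hP, Option.bind_some, M.step_det hl hP, M.step_cor h]
  rfl

/-- Inputs that are safe for each state in the cells of `s`. -/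
def SafeInput (s : Set M.Cell) (u : M.Uc) : Prop :=
  ∀ x, M.ell x ∈ s → ∀ v ∈ M.Vuc, ∀ d, M.IsDisturbance d →
    M.SafeTraj x (M.join (M.τ⁻¹ • u.1) v) d

variable {M}

theorem SafeInput.safeObs {s : Set M.Cell} {u : M.Uc} (h : M.SafeInput s u) (s' : Set M.Cell) :
    M.SafeObs s u s' := by
  rintro I I' - rfl - x hx x' - - v hv d hd -
  exact h x ⟨x, hx, rfl⟩ v hv d hd

/-- `SafeObs` only concerns trajectories that end in a given successor estimate. A trajectory from
`x` to `x'` is caught by the estimate `ell ⁻¹' s` and the correction whose last measurement is `x'`.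
-/
theorem safeInput_of_safeObs {s : Set M.Cell} (hs : s ⊆ range M.ell) {u : M.Uc}
    (h : ∀ φ, (M.next s u φ).Nonempty → M.SafeObs s u (M.next s u φ)) : M.SafeInput s u := by
  intro x hx v hv d hd
  have hpost := M.traj_mem_post x u hv hd
  set x' := M.traj x (M.join (M.τ⁻¹ • u.1) v) d M.τ with hx'
  let φ : M.Phi := (x', fun _ => u, x')
  have hmem : x' ∈ M.predict (M.ell ⁻¹' s) u ∩ M.hatI φ :=
    ⟨⟨x, hx, hpost⟩, M.mem_hatI_measurement _ _ _⟩
  have e := M.ell_image_predict_inter_hatI hs u φ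
  have hn : (M.next s u φ).Nonempty := by
    rw [next, ← e]
    exact ⟨_, x', hmem, rfl⟩
  exact h φ hn _ _ (M.estTrans_of_hatI φ ⟨x', hmem⟩) (image_preimage_eq_of_subset hs) e x hx x'
    hmem hpost v hv d hd hx'.symm

/-! ### The supremal controllable sublanguage as a greatest fixed point -/

theorem lang_cycle_append {s : Set M.Cell} {u : M.Uc} {lam : M.LambdaD} {φ : M.Phi}
    (hl : M.NoAlarm lam) (h : (M.next s u φ).Nonempty) (t : List M.ObsEvent) :
    M.Obs.run (.corrected s) ([.inp u, .det lam, .cor (Quotient.mk _ φ)] ++ t) =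
      M.Obs.run (.corrected (M.next s u φ)) t := by
  rw [Generator.run_append, M.run_cycle hl h, Option.bind_some]

theorem exists_cycle_mem {s : Set M.Cell} {u : M.Uc} {K : Set (List M.ObsEvent)}
    (hK : IsControllable M.obsUncontrollable (M.Obs.lang (.corrected s)) K)
    (hu : [ObsEvent.inp u] ∈ prefixClosure K) {lam : M.LambdaD} (hl : M.NoAlarm lam)
    {φ : M.Phi} (h : (M.next s u φ).Nonempty) :
    [ObsEvent.inp u, .det lam, .cor (Quotient.mk _ φ)] ∈ prefixClosure K := by
  have hP := h.mono inter_subset_left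
  have h1 := hK _ hu (.det lam) (fun _ => nofun)
    ⟨.checked (M.obsP s u), by
      simp only [List.cons_append, List.nil_append, Generator.run, M.step_inp hP, Option.bind_some,
        M.step_det hl hP]⟩
  exact hK _ h1 (.cor (Quotient.mk _ φ)) (fun _ => nofun) ⟨_, M.run_cycle hl h⟩

theorem spec_residual {s : Set M.Cell} {u : M.Uc} {lam : M.LambdaD} {φ : M.Phi}
    (hl : M.NoAlarm lam) (h : (M.next s u φ).Nonempty) {t : List M.ObsEvent}
    (ht : [.inp u, .det lam, .cor (Quotient.mk _ φ)] ++ t ∈ M.spec s) :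
    t ∈ M.spec (M.next s u φ) := by
  obtain ⟨⟨y, hy, hr⟩, hsafe⟩ := ht
  rw [lang_cycle_append hl h] at hr
  refine ⟨⟨y, hy, hr⟩, ?_⟩
  rintro t₁ t₂ v lamd lamc s₁ s₂ rfl h₁ h₂
  exact hsafe ([.inp u, .det lam, .cor (Quotient.mk _ φ)] ++ t₁) t₂ v lamd lamc s₁ s₂
    (by simp only [List.append_assoc]) (by rw [lang_cycle_append hl h]; exact h₁) h₂

theorem bscpnb_safeInput {s : Set M.Cell} (hs : s ⊆ range M.ell) {u : M.Uc}
    (hu : u ∈ M.bscpnb s) : M.SafeInput s u := by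
  obtain ⟨t, K, ⟨hK, hc⟩, ht⟩ := hu
  refine safeInput_of_safeObs hs fun φ h => ?_
  obtain ⟨lam, hl⟩ := M.exists_noAlarm
  obtain ⟨t', ht'⟩ := exists_cycle_mem hc ⟨t, ht⟩ hl h
  exact (hK ht').2 [] t' u lam (Quotient.mk _ φ) s _ rfl rfl (M.run_cycle hl h)

theorem bscpnb_next_nonempty {s : Set M.Cell} {u : M.Uc} (hu : u ∈ M.bscpnb s) {φ : M.Phi}
    (h : (M.next s u φ).Nonempty) (hq : M.next s u φ ≠ {M.qm}) :
    (M.bscpnb (M.next s u φ)).Nonempty := by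
  obtain ⟨t, K, ⟨hK, hc⟩, ht⟩ := hu
  obtain ⟨lam, hl⟩ := M.exists_noAlarm
  obtain ⟨t', ht'⟩ := exists_cycle_mem hc ⟨t, ht⟩ hl h
  obtain ⟨⟨y, hy, hr⟩, -⟩ := spec_residual hl h (hK ht')
  -- If nothing follows the cycle, its end state is marked. Otherwise the next event is an input
  -- `v`, enabled by the residual of `K` after the cycle, which is again a controllable sublanguage
  -- of the specification.
  rcases t' with _ | ⟨e, t'⟩
  · cases hr
    exact absurd hy hq
  obtain ⟨z, hz, -⟩ := Option.bind_eq_some_iff.1 hr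
  rcases M.step_eq_some hz with ⟨_, v, -, rfl, -⟩ | ⟨_, _, h', -⟩ | ⟨_, _, h', -⟩
  · refine ⟨v, t', {r | [ObsEvent.inp u, .det lam, .cor (Quotient.mk _ φ)] ++ r ∈ K},
      ⟨fun r hr => spec_residual hl h (hK hr), ?_⟩, ht'⟩
    rintro r ⟨r', hr'⟩ e he ⟨y, hy⟩
    obtain ⟨r'', hr''⟩ := hc ([.inp u, .det lam, .cor (Quotient.mk _ φ)] ++ r)
      ⟨r', by rw [List.append_assoc]; exact hr'⟩ e he
      ⟨y, by rw [List.append_assoc, lang_cycle_append hl h]; exact hy⟩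
    exact ⟨r'', by simpa only [mem_ofPred_eq, List.append_assoc] using hr''⟩
  · cases h'
  · cases h'

/-! ### Progress -/

theorem le_exit_of_mem_range {q : M.Cell} (hq : q ∈ range M.ell) {i : Fin M.n} {r : ℝ}
    (h : q i = some r) : r ≤ M.exit i := by
  obtain ⟨x, rfl⟩ := hq
  rw [ell_apply] at h
  split_ifs at h with hx
  cases h
  obtain ⟨c, hc⟩ := M.exists_exit_eq i
  rw [hc, ← idx_le_iff] at hx
  rwa [M.le_exit_iff i hc]

/-- Each vehicle that has not passed does so in less than `N` steps. -/
def PassesWithin (s : Set M.Cell) (N : ℕ) : Prop :=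
  ∀ q ∈ s, ∀ i r, q i = some r → M.exit i < r + N * (M.τ * M.μ)

theorem PassesWithin.eq_qm {s : Set M.Cell} (h : PassesWithin s 0) (hs : s ⊆ range M.ell)
    (hn : s.Nonempty) : s = {M.qm} := by
  refine hn.subset_singleton_iff.1 fun q hq => funext fun i => ?_
  rcases e : q i with _ | r
  · rfl
  · have h1 := h q hq i r e
    have h2 := le_exit_of_mem_range (hs hq) e
    simp at h1
    linarith

theorem PassesWithin.mono {s t : Set M.Cell} {N : ℕ} (h : PassesWithin t N) (hst : s ⊆ t) :
    PassesWithin s N := fun q hq => h q (hst hq)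

theorem PassesWithin.obsP {s : Set M.Cell} {N : ℕ} (h : PassesWithin s (N + 1)) (u : M.Uc) :
    PassesWithin (M.obsP s u) N := by
  rintro _ ⟨q, hq, w, hw, δ, hδ, rfl⟩ i r hr
  obtain ⟨r', hr', hr⟩ := Option.bind_eq_some_iff.1 hr
  split_ifs at hr
  cases hr
  have h1 := h q hq i r' hr'
  have h2 := M.step_le_join_add u hw (M.W_subset_Δ hδ) i
  push_cast at h1
  linarith

theorem exists_passesWithin_of_le (b : M.State) {I : Set M.State}
    (h : ∀ x ∈ I, ∀ i, x i ≤ M.exit i → b i ≤ x i) : ∃ N, PassesWithin (M.ell '' I) N := by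
  have hs := M.step_pos
  -- The extra half cell covers the distance from a position to its cell centre.
  have key (i : Fin M.n) : ∀ᶠ N : ℕ in Filter.atTop,
      M.exit i - b i + M.τ * M.μ / 2 < N * (M.τ * M.μ) :=
    (tendsto_natCast_atTop_atTop.atTop_mul_const hs).eventually_gt_atTop _
  obtain ⟨N, hN⟩ := (Filter.eventually_all.2 key).exists
  refine ⟨N, ?_⟩
  rintro _ ⟨x, hx, rfl⟩ i r hr
  rw [ell_apply] at hr
  split_ifs at hr with hxi
  cases hr
  have h1 := (M.idx_le_iff (x i) _).1 le_rfl
  have h2 := h x hx i hxi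
  have h3 := hN i
  linarith

/-- Up to passed vehicles, a state in `hatI φ` is the last measurement or lies ahead of the first
one, so unpassed vehicles are bounded below. A single correction thus bounds the time to go, even if
the previous estimate was unbounded. -/
theorem exists_passesWithin_hatI (φ : M.Phi) : ∃ N, PassesWithin (M.ell '' M.hatI φ) N := by
  refine exists_passesWithin_of_le (fun i => min (φ.1 i) (φ.2.2 i)) ?_
  rintro x ⟨y, hy, hxy⟩ i hi
  rcases hxy i with e | ⟨h, -⟩
  · rw [e]
    rcases hy with hy | rfl
    · exact min_le_of_left_le (M.le_of_mem_postSeq hy i)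
    · exact min_le_right _ _
  · exact absurd hi (not_le.2 h)

/-! ### Policies on information states -/

/-- All inputs in the string are chosen by the policy `P`. -/
def Follows (P : Set M.Cell → Set M.Uc) : M.ObsState → List M.ObsEvent → Prop
  | _, [] => True
  | x, e :: t => (∀ s u, x = .corrected s → e = .inp u → u ∈ P s) ∧
      ∀ y, M.Obs.step x e = some y → Follows P y t

theorem follows_append {P : Set M.Cell → Set M.Uc} {x : M.ObsState} {s t : List M.ObsEvent} :
    Follows P x (s ++ t) ↔ Follows P x s ∧ ∀ y, M.Obs.run x s = some y → Follows P y t := by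
  induction s generalizing x with
  | nil => simp [Follows, Generator.run]
  | cons e s ih =>
    simp only [List.cons_append, Follows, ih, Generator.run, Option.bind_eq_some_iff]
    constructor
    · rintro ⟨h1, h2⟩
      exact ⟨⟨h1, fun y hy => (h2 y hy).1⟩, fun z ⟨y, hy, hz⟩ => (h2 y hy).2 z hz⟩
    · rintro ⟨⟨h1, h2⟩, h3⟩
      exact ⟨h1, fun y hy => ⟨h2 y hy, fun z hz => h3 z ⟨y, hy, hz⟩⟩⟩

/-- After each correction, the information state is marked or the policy enables an input. -/
def NeverBlocks (P : Set M.Cell → Set M.Uc) (s : Set M.Cell) : Prop :=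
  s.Nonempty ∧ s ⊆ range M.ell ∧ ∀ φ, (s ∩ M.ell '' M.hatI φ).Nonempty →
    s ∩ M.ell '' M.hatI φ ≠ {M.qm} → (P (s ∩ M.ell '' M.hatI φ)).Nonempty

/-- Invariant of the observer under a policy. -/
def PolicyInvariant (P : Set M.Cell → Set M.Uc) : M.ObsState → Prop
  | .predicted s => NeverBlocks P s
  | .checked s => NeverBlocks P s
  | .corrected s => s.Nonempty ∧ s ⊆ range M.ell ∧ (∃ N, PassesWithin s N) ∧
      (s ≠ {M.qm} → (P s).Nonempty)

/-- A policy which enables safe inputs only, and which enables some input at each unmarked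
information state that it can lead to. -/
def IsWinning (P : Set M.Cell → Set M.Uc) : Prop :=
  ∀ s ⊆ range M.ell, ∀ u ∈ P s, M.SafeInput s u ∧
    ∀ φ, (M.next s u φ).Nonempty → M.next s u φ ≠ {M.qm} → (P (M.next s u φ)).Nonempty

theorem IsWinning.neverBlocks {P : Set M.Cell → Set M.Uc} (hP : IsWinning P) {s : Set M.Cell}
    (hn : s.Nonempty) (hs : s ⊆ range M.ell) {u : M.Uc} (hu : u ∈ P s) :
    NeverBlocks P (M.obsP s u) :=
  ⟨M.obsP_nonempty hn u, M.obsP_subset_range hs u, (hP s hs u hu).2⟩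

theorem NeverBlocks.corrected {P : Set M.Cell → Set M.Uc} {s : Set M.Cell} (h : NeverBlocks P s)
    {φ : M.Phi} (hn : (s ∩ M.ell '' M.hatI φ).Nonempty) :
    PolicyInvariant P (.corrected (s ∩ M.ell '' M.hatI φ)) :=
  ⟨hn, inter_subset_left.trans h.2.1,
    (exists_passesWithin_hatI φ).imp fun _ h' => h'.mono inter_subset_right, h.2.2 φ hn⟩

theorem IsWinning.invariant_step {P : Set M.Cell → Set M.Uc} (hP : IsWinning P)
    {x y : M.ObsState} {e : M.ObsEvent} (hx : PolicyInvariant P x)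
    (he : ∀ s u, x = .corrected s → e = .inp u → u ∈ P s) (h : M.Obs.step x e = some y) :
    PolicyInvariant P y := by
  rcases M.step_eq_some h with ⟨s, u, rfl, rfl, rfl⟩ | ⟨s, lam, rfl, rfl, rfl⟩ |
    ⟨s, φ, rfl, rfl, hn, rfl⟩
  · exact hP.neverBlocks hx.1 hx.2.1 (he s u rfl rfl)
  · exact hx
  · exact NeverBlocks.corrected hx hn

theorem IsWinning.invariant_run {P : Set M.Cell → Set M.Uc} (hP : IsWinning P)
    {x y : M.ObsState} {t : List M.ObsEvent} (hx : PolicyInvariant P x) (ht : Follows P x t)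
    (h : M.Obs.run x t = some y) : PolicyInvariant P y := by
  induction t generalizing x with
  | nil => cases h; exact hx
  | cons e t ih =>
    obtain ⟨z, hz, h⟩ := Option.bind_eq_some_iff.1 h
    exact ih (hP.invariant_step hx ht.1 hz) (ht.2 z hz) h

/-- A marked state can be reached by following the policy. -/
def CanFinish (P : Set M.Cell → Set M.Uc) (x : M.ObsState) : Prop :=
  ∃ t, Follows P x t ∧ ∃ y ∈ M.Obs.marked, M.Obs.run x t = some y

theorem CanFinish.of_step {P : Set M.Cell → Set M.Uc} {x y : M.ObsState} {e : M.ObsEvent}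
    (hy : CanFinish P y) (he : ∀ s u, x = .corrected s → e = .inp u → u ∈ P s)
    (h : M.Obs.step x e = some y) : CanFinish P x := by
  obtain ⟨t, ht, z, hz, hr⟩ := hy
  refine ⟨e :: t, ⟨he, fun y' hy' => ?_⟩, z, hz, ?_⟩
  · rw [h] at hy'
    cases hy'
    exact ht
  · rw [Generator.run, h, Option.bind_some, hr]

theorem CanFinish.of_corrected {P : Set M.Cell → Set M.Uc} {s : Set M.Cell} {φ : M.Phi}
    (hn : (s ∩ M.ell '' M.hatI φ).Nonempty)
    (h : CanFinish P (.corrected (s ∩ M.ell '' M.hatI φ))) :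
    CanFinish P (.checked s) ∧ CanFinish P (.predicted s) := by
  obtain ⟨lam, hl⟩ := M.exists_noAlarm
  have h1 := h.of_step (e := .cor (Quotient.mk _ φ)) nofun (M.step_cor hn)
  exact ⟨h1, h1.of_step nofun (M.step_det hl (hn.mono inter_subset_left))⟩

/-- Induction on the number of steps to go: each cycle with a policy input uses one. Before a
correction no bound need be known, so the pending cycle is completed first. -/
theorem IsWinning.canFinish {P : Set M.Cell → Set M.Uc} (hP : IsWinning P) {x : M.ObsState}
    (hx : PolicyInvariant P x) : CanFinish P x := by
  have key (N : ℕ) : ∀ s, PolicyInvariant P (.corrected s) → PassesWithin s N →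
      CanFinish P (.corrected s) := by
    induction N with
    | zero =>
      intro s hs hN
      exact ⟨[], trivial, _, hN.eq_qm hs.2.1 hs.1, rfl⟩
    | succ N ih =>
      intro s hs hN
      by_cases hq : s = {M.qm}
      · exact ⟨[], trivial, _, hq, rfl⟩
      obtain ⟨u, hu⟩ := hs.2.2.2 hq
      have hb := hP.neverBlocks hs.1 hs.2.1 hu
      obtain ⟨φ, hφ⟩ := M.exists_correction hb.1 hb.2.1
      refine (CanFinish.of_corrected hφ (ih _ (hb.corrected hφ)
        ((hN.obsP u).mono inter_subset_left))).2.of_step ?_ (M.step_inp hb.1)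
      rintro _ _ ⟨⟩ ⟨⟩
      exact hu
  rcases x with s | s | s
  · obtain ⟨φ, hφ⟩ := M.exists_correction hx.1 hx.2.1
    have hc := NeverBlocks.corrected hx hφ
    obtain ⟨N, hN⟩ := hc.2.2.1
    exact (CanFinish.of_corrected hφ (key N _ hc hN)).2
  · obtain ⟨φ, hφ⟩ := M.exists_correction hx.1 hx.2.1
    have hc := NeverBlocks.corrected hx hφ
    obtain ⟨N, hN⟩ := hc.2.2.1
    exact (CanFinish.of_corrected hφ (key N _ hc hN)).1
  · obtain ⟨N, hN⟩ := hx.2.2.1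
    exact key N s hx hN

theorem IsWinning.marked_mem_spec {P : Set M.Cell → Set M.Uc} (hP : IsWinning P)
    {s : Set M.Cell} {t : List M.ObsEvent} (ht : t ∈ M.Obs.markedLang (.corrected s))
    (hf : Follows P (.corrected s) t) : t ∈ M.spec s := by
  refine ⟨ht, ?_⟩
  rintro t₁ t₂ u lamd lamc s₁ s₂ rfl h₁ -
  rw [List.append_assoc, follows_append] at hf
  have hu : u ∈ P s₁ := (hf.2 _ h₁).1 s₁ u rfl rfl
  intro I I' hI hs
  exact (hP s₁ (hs ▸ image_subset_range _ _) u hu).1.safeObs s₂ I I' hI hs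

/-- Winning policies are contained in the solution of the basic supervisory control problem. -/
theorem IsWinning.subset_bscpnb {P : Set M.Cell → Set M.Uc} (hP : IsWinning P) {s : Set M.Cell}
    (hn : s.Nonempty) (hs : s ⊆ range M.ell) : P s ⊆ M.bscpnb s := by
  intro u hu
  let K : Set (List M.ObsEvent) :=
    {t | t ∈ M.Obs.markedLang (.corrected s) ∧ Follows P (.corrected s) t}
  have hext {t : List M.ObsEvent} {y : M.ObsState} (hf : Follows P (.corrected s) t)
      (hr : M.Obs.run (.corrected s) t = some y) (hy : PolicyInvariant P y) :
      t ∈ prefixClosure K := by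
    obtain ⟨t', hf', z, hz, hr'⟩ := hP.canFinish hy
    refine ⟨t', ⟨z, hz, by rw [Generator.run_append, hr, Option.bind_some, hr']⟩,
      follows_append.2 ⟨hf, fun y' hy' => ?_⟩⟩
    rw [hr] at hy'
    cases hy'
    exact hf'
  have hinp {v : M.Uc} (hv : v ∈ P s) : PolicyInvariant P (.predicted (M.obsP s v)) :=
    hP.neverBlocks hn hs hv
  have hc : IsControllable M.obsUncontrollable (M.Obs.lang (.corrected s)) K := by
    rintro t ⟨t', -, hf⟩ e he ⟨y, hy⟩
    have hf := (follows_append.1 hf).1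
    have hfe : Follows P (.corrected s) (t ++ [e]) :=
      follows_append.2 ⟨hf, fun z _ => ⟨fun _ v _ h => absurd h (he v), fun _ _ => trivial⟩⟩
    refine hext hfe hy ?_
    -- The initial `s` may be unbounded below and so violate `PolicyInvariant`. No uncontrollable
    -- event is defined there, and the invariant holds from the first input on.
    rcases t with _ | ⟨e', t⟩
    · obtain ⟨z, hz, -⟩ := Option.bind_eq_some_iff.1 hy
      rcases M.step_eq_some hz with ⟨_, v, -, h, -⟩ | ⟨_, _, h, -⟩ | ⟨_, _, h, -⟩
      · exact absurd h (he v)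
      · cases h
      · cases h
    · obtain ⟨z, hz, hy⟩ := Option.bind_eq_some_iff.1 hy
      rcases M.step_eq_some hz with ⟨s', v, h, rfl, rfl⟩ | ⟨_, _, h, -⟩ | ⟨_, _, h, -⟩
      · cases h
        exact hP.invariant_run (hinp (hfe.1 s v rfl rfl)) (hfe.2 _ hz) hy
      · cases h
      · cases h
  have hPn := M.obsP_nonempty hn u
  have hf : Follows P (.corrected s) [.inp u] := by
    refine ⟨?_, fun _ _ => trivial⟩
    rintro _ _ ⟨⟩ ⟨⟩
    exact hu
  obtain ⟨t, ht⟩ := hext hf (by rw [Generator.run, M.step_inp hPn]; rfl) (hinp hu)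
  exact ⟨t, K, ⟨fun t ht => hP.marked_mem_spec ht.1 ht.2, hc⟩, ht⟩

/-- Inputs which are enabled at an information state are enabled at smaller ones. -/
theorem bscpnb_anti {s t : Set M.Cell} (hn : s.Nonempty) (hst : s ⊆ t) (ht : t ⊆ range M.ell) :
    M.bscpnb t ⊆ M.bscpnb s := by
  -- The policy may use at `s` whatever the solution enables at some larger information state. It is
  -- winning because `next` is monotone, and a nonempty subset of `{qm}` is `{qm}`.
  let P : Set M.Cell → Set M.Uc := fun s => {u | ∃ t ⊆ range M.ell, s ⊆ t ∧ u ∈ M.bscpnb t}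
  have hP : IsWinning P := by
    rintro s - u ⟨t, ht, hst, hu⟩
    refine ⟨fun x hx => bscpnb_safeInput ht hu x (hst hx), fun φ hn hq => ?_⟩
    have hsub := M.next_mono hst u φ
    obtain ⟨v, hv⟩ := bscpnb_next_nonempty hu (hn.mono hsub)
      fun h => hq (hn.subset_singleton_iff.1 (h ▸ hsub))
    exact ⟨v, _, M.next_subset_range t u φ, hsub, hv⟩
  exact fun u hu => hP.subset_bscpnb hn (hst.trans ht) ⟨t, ht, hst, hu⟩

end Intersection

namespace Intersection

variable (M : Intersection)

/-! ### The resilient supervisor -/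

theorem input_eq_of_smul_eq {u v : M.Uc} (h : M.τ⁻¹ • u.1 = M.τ⁻¹ • v.1) : u = v :=
  Subtype.ext (smul_right_injective _ (inv_ne_zero M.τ_pos.ne') h)

theorem smul_mem_resilientSupervisor {I : Set M.State} {u : M.Uc} :
    M.τ⁻¹ • u.1 ∈ M.resilientSupervisor I ↔ u ∈ M.bscpnb (M.ell '' I) := by
  constructor
  · rintro ⟨v, hv, h⟩
    rwa [M.input_eq_of_smul_eq h]
  · exact fun h => ⟨u, h, rfl⟩

theorem isSupervisor_resilientSupervisor : M.IsSupervisor M.resilientSupervisor := by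
  refine ⟨?_, fun I J h => by simp only [resilientSupervisor, h]⟩
  rintro I _ ⟨⟨u, v, hv, rfl⟩, -, rfl⟩
  rwa [inv_smul_smul₀ M.τ_pos.ne']

theorem isSafe_resilientSupervisor : M.IsSafe M.resilientSupervisor := by
  rintro I _ ⟨u, hu, rfl⟩ x hx
  exact bscpnb_safeInput (image_subset_range _ _) hu x ⟨x, hx, rfl⟩

theorem ell_image_inter_subset_next (I : Set M.State) (u : M.Uc) (φ : M.Phi) :
    M.ell '' (M.predict I u ∩ M.hatI φ) ⊆ M.next (M.ell '' I) u φ := by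
  rw [next, ← ell_image_predict]
  exact image_inter_subset _ _ _

theorem isNonblocking_resilientSupervisor : M.IsNonblocking M.resilientSupervisor := by
  rintro I u hu _ ⟨hn, φ, -, -, -, -, rfl⟩ hq
  rw [smul_mem_resilientSupervisor] at hu
  have hsub := M.ell_image_inter_subset_next I u φ
  have hn := hn.image M.ell
  obtain ⟨v, hv⟩ := bscpnb_next_nonempty hu (hn.mono hsub)
    fun h => hq (hn.subset_singleton_iff.1 (h ▸ hsub))
  exact ⟨_, v, bscpnb_anti hn hsub (M.next_subset_range _ _ _) hv, rfl⟩

theorem isMaximallyPermissive_resilientSupervisor :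
    M.IsMaximallyPermissive M.resilientSupervisor := by
  intro σ hσ hsafe hnb I hI v hv
  -- `σ` is read on full unions of cells, where estimator and observer transitions agree exactly.
  -- This costs nothing, since `σ` depends only on the discretization.
  let P : Set M.Cell → Set M.Uc := fun s => {u | M.τ⁻¹ • u.1 ∈ σ (M.ell ⁻¹' s)}
  have hσP {J : Set M.State} {w : M.ctrl → ℝ} (hw : w ∈ σ J) :
      ∃ u ∈ P (M.ell '' J), w = M.τ⁻¹ • u.1 := by
    refine ⟨⟨M.τ • w, w, hσ.1 J hw, rfl⟩, ?_, (inv_smul_smul₀ M.τ_pos.ne' w).symm⟩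
    change M.τ⁻¹ • M.τ • w ∈ σ _
    rwa [inv_smul_smul₀ M.τ_pos.ne',
      hσ.2 _ J (image_preimage_eq_of_subset (image_subset_range _ _))]
  have hP : IsWinning P := by
    refine fun s hs u hu => ⟨fun x hx => hsafe _ _ hu x hx, fun φ hn hq => ?_⟩
    have e := M.ell_image_predict_inter_hatI hs u φ
    rw [next, ← e] at hn hq ⊢
    obtain ⟨w, hw⟩ := hnb _ u hu _ (M.estTrans_of_hatI φ (image_nonempty.1 hn)) hq
    obtain ⟨u', hu', -⟩ := hσP hw
    exact ⟨u', hu'⟩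
  obtain ⟨u, hu, rfl⟩ := hσP hv
  exact ⟨u, hP.subset_bscpnb (hI.image _) (image_subset_range _ _) hu, rfl⟩

/-! ### Resilience of the closed loop -/

theorem postSeq_succ {N : ℕ} {x y z : M.State} {us : Fin (N + 1) → M.Uc}
    (hy : y ∈ M.postSeq x (fun j : Fin N => us j.castSucc)) (hz : z ∈ M.post y (us (Fin.last N))) :
    z ∈ M.postSeq x us := by
  obtain ⟨w, δ, hw, hδ, rfl⟩ := hy
  obtain ⟨w', hw', δ', hδ', rfl⟩ := hz
  refine ⟨Fin.snoc (α := fun _ => _) w w', Fin.snoc (α := fun _ => _) δ δ', fun j => ?_, fun j => ?_,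
    ?_⟩
  · refine Fin.lastCases ?_ (fun j => ?_) j
    · simpa using hw'
    · simpa using hw j
  · refine Fin.lastCases ?_ (fun j => ?_) j
    · simpa using hδ'
    · simpa using hδ j
  · rw [Fin.sum_univ_castSucc]
    simp only [Fin.snoc_castSucc, Fin.snoc_last]
    abel

/-- Sampled states of a solution of the plant lie in the multi-step reachable sets. -/
theorem mem_postSeq_of_forall_mem_post {x : ℕ → M.State} {u : ℕ → M.Uc} {k : ℕ} (N : ℕ)
    (h : ∀ j < N, x (k + j + 1) ∈ M.post (x (k + j)) (u (k + j))) :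
    x (k + N) ∈ M.postSeq (x k) fun j : Fin N => u (k + j) := by
  induction N with
  | zero => exact ⟨fun j => j.elim0, fun j => j.elim0, fun j => j.elim0, fun j => j.elim0, by simp⟩
  | succ N ih =>
    exact M.postSeq_succ (us := fun j => u (k + j)) (ih fun j hj => h j (by omega))
      (h N (by omega))

theorem exists_predecessor (x : M.State) (u : M.Uc) : ∃ y, x ∈ M.post y u := by
  obtain ⟨w, hw⟩ := M.Uuc_nonempty
  obtain ⟨δ, hδ⟩ := M.W_nonempty
  exact ⟨x - M.join u w - δ, w, hw, δ, M.W_subset_Δ hδ, by abel⟩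

/-- A state from which `x` can be reached in `N` steps. -/
theorem exists_predecessors (x : M.State) (u : M.Uc) (N : ℕ) :
    ∃ y : ℕ → M.State, y N = x ∧ ∀ j < N, y (j + 1) ∈ M.post (y j) u := by
  induction N with
  | zero => exact ⟨fun _ => x, rfl, nofun⟩
  | succ N ih =>
    obtain ⟨y, hy, h⟩ := ih
    obtain ⟨z, hz⟩ := M.exists_predecessor (y 0) u
    refine ⟨fun j => Nat.casesOn j z y, hy, fun j hj => ?_⟩
    rcases j with _ | j
    · exact hz
    · exact h j (by omega)

/-! ### Estimates during the start-up phase, and progress -/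

variable {M}

/-- States reachable in `k` steps of the closed loop from a single initial state. -/
def Signals.reach (r : M.Signals) (x : M.State) : ℕ → Set M.State
  | 0 => {x}
  | k + 1 => M.predict (Signals.reach r x k) (r.u k)

theorem Signals.exists_path {r : M.Signals} {x : M.State} {k : ℕ} {y : M.State}
    (hy : y ∈ r.reach x k) : ∃ z : ℕ → M.State, z 0 = x ∧ z k = y ∧
      ∀ j < k, z (j + 1) ∈ M.post (z j) (r.u j) := by
  induction k generalizing y with
  | zero => exact ⟨fun _ => x, rfl, hy.symm, nofun⟩
  | succ k ih =>
    obtain ⟨y', hy', h⟩ := hy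
    obtain ⟨z, h0, hk, hz⟩ := ih hy'
    refine ⟨fun j => if j ≤ k then z j else y, by simpa using h0, by simp, fun j hj => ?_⟩
    by_cases hjk : j < k
    · simpa [hjk.le, Nat.succ_le_of_lt hjk] using hz j hjk
    · obtain rfl : j = k := by omega
      simpa [hk] using h

/-- Before time `T` a fictitious past is prepended to `x`, so that every state reachable in `k`
steps becomes reachable in `T` steps from one earlier state. The resulting correction removes
nothing. -/
theorem Signals.reach_subset_hatI (r : M.Signals) (x y : M.State) {k : ℕ} (hk : k ≤ M.T) :
    ∃ φ : M.Phi, r.reach x k ⊆ M.hatI φ := by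
  obtain ⟨p, hp, hpost⟩ := M.exists_predecessors x (r.u 0) (M.T - k)
  -- Truncated subtraction makes `r.u 0` the input throughout the fictitious past.
  let v : ℕ → M.Uc := fun j => r.u (j - (M.T - k))
  refine ⟨(p 0, fun j => v (0 + j), y), fun z hz => ⟨z, .inl ?_, SameUpToPassed.refl M z⟩⟩
  obtain ⟨q, h0, hq, hstep⟩ := exists_path hz
  have := M.mem_postSeq_of_forall_mem_post (k := 0) M.T (u := v)
    (x := fun j => if j ≤ M.T - k then p j else q (j - (M.T - k))) (fun j hj => ?_)
  · by_cases hk0 : k = 0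
    · subst hk0
      rw [Nat.sub_zero] at hp
      simpa [← hq, h0, hp] using this
    · have h1 : ¬ M.T ≤ M.T - k := by have := M.T_pos; omega
      have h2 : M.T - (M.T - k) = k := by omega
      simpa [h1, h2, hq] using this
  · simp only [zero_add, v]
    rcases lt_trichotomy j (M.T - k) with h | h | h
    · rw [if_pos h.le, if_pos (by omega), show j - (M.T - k) = 0 by omega]
      exact hpost j h
    · rw [if_pos h.le, if_neg (by omega), h, hp, ← h0, Nat.sub_self,
        show M.T - k + 1 - (M.T - k) = 0 + 1 by omega]
      exact hstep 0 (by omega)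
    · rw [if_neg (by omega), if_neg (by omega),
        show j + 1 - (M.T - k) = j - (M.T - k) + 1 by omega]
      exact hstep _ (by omega)

/-- Before the first correction, the estimate is the reachable set up to discretization. -/
theorem Signals.ell_image_est (r : M.Signals) {X₀ : Set M.State} {x : M.State}
    (h : M.ell '' X₀ = {M.ell x}) {k : ℕ} (hk : k < M.T) :
    M.ell '' r.est X₀ k = M.ell '' r.reach x k := by
  induction k with
  | zero => rw [Signals.est, Signals.reach, h, image_singleton]
  | succ k ih =>
    have e : r.est X₀ (k + 1) = M.predict (r.est X₀ k) (r.u k) := by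
      ext y
      simp [Signals.est, hk]
    rw [e, Signals.reach, ell_image_predict, ell_image_predict, ih (by omega)]

theorem Signals.passesWithin_est (r : M.Signals) {X₀ : Set M.State} {N : ℕ}
    (h : PassesWithin (M.ell '' X₀) N) {k : ℕ} : PassesWithin (M.ell '' r.est X₀ k) (N - k) := by
  induction k with
  | zero => exact h
  | succ k ih =>
    have hsub : M.ell '' r.est X₀ (k + 1) ⊆ M.obsP (M.ell '' r.est X₀ k) (r.u k) := by
      rw [← ell_image_predict]
      exact image_mono fun y hy => hy.1
    rcases Nat.lt_or_ge k N with hk | hk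
    · rw [show N - k = N - (k + 1) + 1 by omega] at ih
      exact (ih.obsP _).mono hsub
    · rw [show N - k = 0 by omega] at ih
      rw [show N - (k + 1) = 0 by omega]
      -- Once the bound has reached zero it is weakened to one, so that prediction brings it back to
      -- zero.
      have h1 : PassesWithin (M.ell '' r.est X₀ k) (0 + 1) := fun q hq i c hc => by
        have := ih q hq i c hc
        have := M.step_pos
        push_cast at *
        linarith
      exact (h1.obsP _).mono hsub

/-! ### Closed-loop runs under an undetected attack -/

section Run

variable {X₀ : Set M.State} {N : ℕ} {r : M.Signals} {σ : Set M.State → Set (M.ctrl → ℝ)}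

theorem IsRun.mem_post (h : M.IsRun σ X₀ N r) {k : ℕ} (hk : k < N) :
    r.x (k + 1) ∈ M.post (r.x k) (r.u k) := by
  obtain ⟨-, h2, h3, h4, -⟩ := h.2.2 k hk
  rw [h4]
  exact M.traj_mem_post _ _ h2 h3

/-- Either end of a window of `T` steps carries an authentic measurement. -/
theorem IsRun.mem_hatI (h : M.IsRun σ X₀ N r) {k : ℕ} (hk : k + M.T ≤ N) :
    r.x (k + M.T) ∈ M.hatI (r.meas k, fun j => r.u (k + j), r.meas (k + M.T)) := by
  obtain ⟨ks, ke, hlen, hmeas⟩ := h.2.1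
  refine ⟨_, ?_, SameUpToPassed.refl M _⟩
  -- The window ends are `T` steps apart and the half-open attack interval has length at most `T`.
  -- If the last measurement is attacked, the first is authentic and the true state is reachable
  -- from it.
  by_cases hin : k + M.T ∈ Ico ks ke
  · left
    have hout : k ∉ Ico ks ke := fun h' => by
      have := h'.1
      have := hin.2
      omega
    rw [hmeas k (by omega) hout]
    exact M.mem_postSeq_of_forall_mem_post _ fun j hj => h.mem_post (by omega)
  · right
    exact (hmeas _ hk hin).symm

theorem IsRun.mem_est (h : M.IsRun σ X₀ N r) {k : ℕ} (hk : k ≤ N) : r.x k ∈ r.est X₀ k := by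
  induction k with
  | zero => exact h.1
  | succ k ih =>
    refine ⟨⟨_, ih (by omega), h.mem_post hk⟩, fun hT => ?_⟩
    obtain ⟨j, hj⟩ := Nat.exists_eq_add_of_le' hT
    rw [hj, Nat.add_sub_cancel]
    exact h.mem_hatI (hj ▸ hk)

theorem IsRun.estTrans (h : M.IsRun σ X₀ N r) {k : ℕ} (hk : k < N) (hT : M.T ≤ k + 1) :
    M.EstTrans (r.est X₀ k) (r.u k) (r.est X₀ (k + 1)) := by
  have := M.T_pos
  refine ⟨⟨_, h.mem_est hk⟩, (r.meas (k + 1 - M.T), fun j => r.u (k + 1 - M.T + j), r.meas (k + 1)),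
    (r.meas k, r.u k, r.C k), ?_, rfl, (h.2.2 k hk).2.2.2.2, ?_⟩
  · exact congrArg r.u (by change k + 1 - M.T + (M.T - 1) = k; omega)
  · ext y
    simp [Signals.est, hT]

end Run

variable (M)

theorem isResilient_resilientSupervisor : M.IsResilient M.resilientSupervisor := by
  refine fun X₀ => ⟨fun N r h => ⟨fun k hk => h.mem_est hk, fun k hk => ?_, fun k hk hT hq => ?_⟩, ?_⟩
  · obtain ⟨h1, h2, h3, -⟩ := h.2.2 k hk
    exact M.isSafe_resilientSupervisor _ _ h1 _ (h.mem_est hk.le) _ h2 _ h3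
  · have hu := (h.2.2 k hk).1
    by_cases hT' : M.T ≤ k + 1
    · exact M.isNonblocking_resilientSupervisor _ _ hu _ (h.estTrans hk hT') hq
    obtain ⟨q, hX⟩ := hT.resolve_left hT'
    obtain ⟨x, -, rfl⟩ : q ∈ M.ell '' X₀ := by rw [hX]; rfl
    -- The uncorrected step is treated as an observer cycle with a correction that cuts nothing off.
    -- A single initial cell is needed here: the estimate then has the same discretization as the
    -- reachable set of one point.
    obtain ⟨φ, hφ⟩ := r.reach_subset_hatI x x (not_le.1 hT').le
    have e : M.ell '' r.est X₀ (k + 1) = M.next (M.ell '' r.est X₀ k) (r.u k) φ := by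
      rw [r.ell_image_est hX (not_le.1 hT'), next, r.ell_image_est hX (by omega),
        ← ell_image_predict]
      exact (inter_eq_left.2 (image_mono hφ)).symm
    rw [smul_mem_resilientSupervisor] at hu
    have hn : (M.ell '' r.est X₀ (k + 1)).Nonempty := ⟨_, _, h.mem_est hk, rfl⟩
    rw [e] at hn hq
    obtain ⟨v, hv⟩ := bscpnb_next_nonempty hu hn hq
    exact ⟨_, v, e ▸ hv, rfl⟩
  · rintro ⟨q, hX⟩
    obtain ⟨x, -, rfl⟩ : q ∈ M.ell '' X₀ := by rw [hX]; rfl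
    obtain ⟨K, hK⟩ := exists_passesWithin_of_le x (I := {x}) (by rintro _ rfl i -; exact le_rfl)
    rw [image_singleton, ← hX] at hK
    refine ⟨K, fun N r h k hk hKk => ?_⟩
    have hp := r.passesWithin_est hK (k := k)
    rw [Nat.sub_eq_zero_of_le hKk] at hp
    exact hp.eq_qm (image_subset_range _ _) ⟨_, _, h.mem_est hk, rfl⟩

end Intersection

end

theorem theorem1 (M : Intersection) :
    M.IsSupervisor M.resilientSupervisor ∧
    M.IsSafe M.resilientSupervisor ∧
    M.IsNonblocking M.resilientSupervisor ∧
    M.IsMaximallyPermissive M.resilientSupervisor ∧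
    M.IsResilient M.resilientSupervisor :=
  ⟨M.isSupervisor_resilientSupervisor, M.isSafe_resilientSupervisor,
    M.isNonblocking_resilientSupervisor, M.isMaximallyPermissive_resilientSupervisor,
    M.isResilient_resilientSupervisor⟩
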